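/- **Cylinder regularity lemma for $3$-graphs.** *Definitions.* Let $X_1,\dots,X_t$ be finite sets. A $t$-partite $3$-graph $\mathcal H$ on $X_1,\dots,X_t$ is a set of triples of vertices of $X_1\sqcup\dots\sqcup X_t$, each triple having its vertices in three different parts. A *vertex cylinder partition* $\mathcal P_V$ is a partition of $X_1\times\dots\times X_t$ into nonempty product sets (cylinders) $Y=Y_1\times\dots\times Y_t$, $Y_i\subseteq X_i$; $|\mathcal P_V|$ is the number of cylinders. A *cylinder chain partition* $\mathcal P=(\mathcal P_V,\mathcal P_E)$ consists of a vertex cylinder partition $\mathcal P_V$ and, for each $Y\in\mathcal P_V$ and all $i<j$, a partition $\mathcal P_E(Y_i\times Y_j)$ of $Y_i\times Y_j$ into bipartite graphs; $|\mathcal P_E|$ is the maximum of $|\mathcal P_E(Y_i\times Y_j)|$ over all $Y\in\mathcal P_V$ and $i<j$. A tuple $x=(x_1,\dots,x_t)\in X_1\times\dots\times X_t$ determines the cylinder $Y=\mathcal P_V[x]$ containing it, the $t$-partite graph $Z=\mathcal P_E[x]$ on $Y_1\cup\dots\cup Y_t$ formed by the parts $Z_{ij}\in\mathcal P_E(Y_i\times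 Y_j)$ with $(x_i,x_j)\in Z_{ij}$, and the chain $\mathcal H[Y;Z]$ consisting of $Z$ and of the edges of $\mathcal H$ supported on triangles of $Z$. Write $d_{ij}=|Z_{ij}|/(|Y_i||Y_j|)$ and let $\delta(Z)=\prod_{i<j}d_{ij}$ be the *product density* of the chain. The graph $Z$ is *$\alpha$-quasirandom* if for all $i<j$ the function $g(y,w)=\mathbf 1_{(y,w)\in Z_{ij}}-d_{ij}$ on $Y_i\times Y_j$ satisfies $$\sum_{y,y'\in Y_i}\sum_{w,w'\in Y_j}g(y,w)g(y',w)g(y,w')g(y',w')\le\alpha|Y_i|^2|Y_j|^2 .$$ The chain $\mathcal H[Y;Z]$ is *$\eta$-quasirandom* if for all $i<j<k$ the following holds. Let $\Delta_{ijk}$ be the set of triangles of $Z$ in $Y_i\times Y_j\times Y_k$, let $d$ be the fraction of them that are edges of $\mathcal H$ (with $0/0=0$), and let $f(u,v,w)=\mathbf 1_{uvw\in\Delta_{ijk}}(\mathbf 1_{uvw\in\mathcal H}-d)$; then $$\sum_{u_0,u_1\in Y_i}\ \sum_{v_0,v_1\in Y_j}\ \sum_{w_0,w_1\in Y_k}\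 \prod_{a,b,c\in\{0,1\}}f(u_a,v_b,w_c)\le\eta\,(d_{ij}d_{ik}d_{jk})^4|Y_i|^2|Y_j|^2|Y_k|^2 .$$ The chain is *$(\eta,\psi)$-quasirandom* if it is $\eta$-quasirandom and $Z$ is $\psi(\delta(Z))$-quasirandom. $\mathcal H$ is *$(\eta,\psi)$-quasirandom relative to $\mathcal P$* if for at least a $(1-\eta)$-fraction of the tuples $x\in X_1\times\dots\times X_t$ the chain $\mathcal H[\mathcal P_V[x];\mathcal P_E[x]]$ is $(\eta,\psi)$-quasirandom. Finally let $\mathrm{twr}(0,x)=x$ and $\mathrm{twr}(\tau+1,x)=2^{\mathrm{twr}(\tau,x)}$. *Theorem.* Let $t$ be a nonnegative integer, let $0<\eta<t^2$, and let $\psi$ be a real polynomial that maps $(0,1)$ to $(0,1)$, is increasing there, and satisfies $\psi(x)\le 2^{-100}x^{28}$ for all $x\in(0,1)$. Then there is a constant $\delta>0$, depending only on $t,\eta,\psi$, such that every $t$-partite $3$-graph $\mathcal H$ on finite sets $X_1,\dots,X_t$ has a cylinder chain partition $\mathcal P=(\mathcal P_V,\mathcal P_E)$ such that: 1. $\mathcal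 H$ is $(\eta,\psi)$-quasirandom relative to $\mathcal P$; 2. $|\mathcal P_V|\le\mathrm{twr}\Bigl(\bigl\lfloor 10^5t^6/\eta^3\bigr\rfloor,\ \max\bigl\{\psi(\eta/t^2)^{-20},\ \deg\psi\bigr\}\Bigr)$; 3. $|\mathcal P_E|\le\mathrm{twr}\Bigl(\bigl\lfloor 10^5t^6/\eta^3\bigr\rfloor,\ (t^2/\eta)^{10}\Bigr)$; 4. for at least a $(1-\eta)$-fraction of the tuples $x\in X_1\times\dots\times X_t$, the chain $\mathcal H[\mathcal P_V[x];\mathcal P_E[x]]$ has product density at least $\delta$. -/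

import Mathlib

namespace CylinderRegularity

/-- `twr τ x` is the tower of twos of height `τ` with `x` as the top exponent. -/
noncomputable def twr : ℕ → ℝ → ℝ
  | 0, x => x
  | τ + 1, x => (2 : ℝ) ^ twr τ x

section Bipartite

variable {α β : Type*}

/-- The `α`-quasirandomness of a function `f` on `A × B` (with parameter `c`): the weighted count
of four-cycles is at most `c |A|² |B|²`. -/
def IsQuasirandomFun (A : Finset α) (B : Finset β) (f : α → β → ℝ) (c : ℝ) : Prop :=
  ∑ x ∈ A, ∑ x' ∈ A, ∑ y ∈ B, ∑ y' ∈ B, f x y * f x' y * f x y' * f x' y'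
    ≤ c * (A.card : ℝ) ^ 2 * (B.card : ℝ) ^ 2

/-- Edge density of a bipartite graph with parts `A`, `B` and edge set `E ⊆ A × B`. -/
noncomputable def bipDensity (A : Finset α) (B : Finset β) (E : Finset (α × β)) : ℝ :=
  (E.card : ℝ) / ((A.card : ℝ) * (B.card : ℝ))

/-- The bipartite graph `E ⊆ A × B` is `c`-quasirandom: its indicator function minus its density
is a `c`-quasirandom function. -/
def IsQuasirandomPair [DecidableEq α] [DecidableEq β]
    (A : Finset α) (B : Finset β) (E : Finset (α × β)) (c : ℝ) : Prop :=
  IsQuasirandomFun A B (fun x y => (if (x, y) ∈ E then 1 else 0) - bipDensity A B E) c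

end Bipartite

/-- A `t`-partite `3`-graph with vertex parts `X 0, …, X (t - 1)`: the vertex set is the disjoint
union of the parts, and each edge is a set of three vertices from three different parts. -/
structure PartiteThreeGraph {t : ℕ} (X : Fin t → Type*) where
  edges : Finset (Finset (Σ i, X i))
  card_eq_three : ∀ e ∈ edges, e.card = 3
  partite : ∀ e ∈ edges, Set.InjOn Sigma.fst (e : Set (Σ i, X i))

/-- A `t`-partite graph with vertex parts `Y i`, given by a bipartite graph between `Y i` and `Y j`
for each `i < j`. -/
structure PartiteGraph {t : ℕ} {X : Fin t → Type*} (Y : ∀ i, Finset (X i)) where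
  edges : ∀ i j : Fin t, i < j → Finset (X i × X j)
  subset : ∀ (i j : Fin t) (hij : i < j), edges i j hij ⊆ Y i ×ˢ Y j

variable {t : ℕ} {X : Fin t → Type*}

/-- A vertex cylinder partition of `∏ i, X i`: a finite collection of (nonempty) product sets
`∏ i, Y i`, each given by the family `Y` of its sides, such that every tuple lies in exactly one
of them. -/
structure VertexCylinderPartition (X : Fin t → Type*) where
  parts : Finset (∀ i, Finset (X i))
  nonempty : ∀ Y ∈ parts, ∀ i, (Y i).Nonempty
  existsUnique_mem : ∀ x : ∀ i, X i, ∃! Y, Y ∈ parts ∧ ∀ i, x i ∈ Y i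

namespace VertexCylinderPartition

/-- The unique cylinder of the partition containing the tuple `x`. -/
noncomputable def cylinder (P : VertexCylinderPartition X) (x : ∀ i, X i) : ∀ i, Finset (X i) :=
  (P.existsUnique_mem x).choose

theorem cylinder_mem (P : VertexCylinderPartition X) (x : ∀ i, X i) : P.cylinder x ∈ P.parts :=
  (P.existsUnique_mem x).choose_spec.1.1

theorem mem_cylinder (P : VertexCylinderPartition X) (x : ∀ i, X i) (i : Fin t) :
    x i ∈ P.cylinder x i :=
  (P.existsUnique_mem x).choose_spec.1.2 i

end VertexCylinderPartition

/-- The property `p` holds for at least a `c`-fraction of the tuples in `∏ i, X i`. -/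
def HoldsForFraction [∀ i, Fintype (X i)] (c : ℝ) (p : (∀ i, X i) → Prop) : Prop :=
  c * (Nat.card (∀ i, X i) : ℝ) ≤ (Nat.card {x : ∀ i, X i // p x} : ℝ)

variable [∀ i, DecidableEq (X i)]

namespace PartiteGraph

variable {Y : ∀ i, Finset (X i)}

/-- The graph is `c`-quasirandom: each of its bipartite graphs is. -/
def IsQuasirandom (G : PartiteGraph Y) (c : ℝ) : Prop :=
  ∀ (i j : Fin t) (hij : i < j), IsQuasirandomPair (Y i) (Y j) (G.edges i j hij) c

/-- Density of the bipartite graph between the parts `i < j`. -/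
noncomputable def density (G : PartiteGraph Y) (i j : Fin t) (hij : i < j) : ℝ :=
  bipDensity (Y i) (Y j) (G.edges i j hij)

/-- The product density `δ(G) = ∏_{i < j} d_G(Y i, Y j)`. -/
noncomputable def productDensity (G : PartiteGraph Y) : ℝ :=
  ∏ p : {p : Fin t × Fin t // p.1 < p.2}, G.density p.1.1 p.1.2 p.2

/-- The triangles of `G` between the parts `i < j < k`. -/
def triangles (G : PartiteGraph Y) (i j k : Fin t) (hij : i < j) (hjk : j < k) :
    Finset (X i × X j × X k) :=
  (Y i ×ˢ Y j ×ˢ Y k).filter fun v =>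
    (v.1, v.2.1) ∈ G.edges i j hij ∧ (v.1, v.2.2) ∈ G.edges i k (hij.trans hjk) ∧
      (v.2.1, v.2.2) ∈ G.edges j k hjk

end PartiteGraph

namespace PartiteThreeGraph

variable {Y : ∀ i, Finset (X i)}

/-- The three vertices form an edge of `H`. -/
def IsEdge (H : PartiteThreeGraph X) {i j k : Fin t} (x : X i) (y : X j) (z : X k) : Prop :=
  ({⟨i, x⟩, ⟨j, y⟩, ⟨k, z⟩} : Finset (Σ i, X i)) ∈ H.edges

instance (H : PartiteThreeGraph X) {i j k : Fin t} (x : X i) (y : X j) (z : X k) :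
    Decidable (H.IsEdge x y z) :=
  inferInstanceAs (Decidable (_ ∈ H.edges))

/-- The relative density, in the triangles of `G` between the parts `i < j < k`, of the edges of
`H` supported on these triangles (with `0 / 0 = 0`). -/
noncomputable def relDensity (H : PartiteThreeGraph X) (G : PartiteGraph Y)
    (i j k : Fin t) (hij : i < j) (hjk : j < k) : ℝ :=
  (((G.triangles i j k hij hjk).filter fun v => H.IsEdge v.1 v.2.1 v.2.2).card : ℝ) /
    ((G.triangles i j k hij hjk).card : ℝ)

/-- The balanced function `(1_{xyz ∈ E(H)} - d(H | G)) 1_{xyz ∈ Δ(G)}` on the parts `i < j < k`. -/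
noncomputable def balanced (H : PartiteThreeGraph X) (G : PartiteGraph Y)
    (i j k : Fin t) (hij : i < j) (hjk : j < k) (x : X i) (y : X j) (z : X k) : ℝ :=
  if (x, y, z) ∈ G.triangles i j k hij hjk then
    (if H.IsEdge x y z then 1 else 0) - H.relDensity G i j k hij hjk
  else 0

/-- For the chain `H[Y; G]` (the graph `G` on `⋃ Y i`, with the edges of `H` supported on the
triangles of `G`): the tripartite subchain on the parts `i < j < k` is `η`-quasirandom, in terms of
the weighted count of octahedra. -/
def IsQuasirandomOnTriple (H : PartiteThreeGraph X) (G : PartiteGraph Y) (η : ℝ)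
    (i j k : Fin t) (hij : i < j) (hjk : j < k) : Prop :=
  let f := H.balanced G i j k hij hjk
  ∑ x ∈ Y i, ∑ x' ∈ Y i, ∑ y ∈ Y j, ∑ y' ∈ Y j, ∑ z ∈ Y k, ∑ z' ∈ Y k,
      f x y z * f x y z' * f x y' z * f x y' z' * f x' y z * f x' y z' * f x' y' z * f x' y' z'
    ≤ η * (G.density i j hij * G.density i k (hij.trans hjk) * G.density j k hjk) ^ 4 *
        ((Y i).card : ℝ) ^ 2 * ((Y j).card : ℝ) ^ 2 * ((Y k).card : ℝ) ^ 2

/-- The chain `H[Y; G]` is `(η, ψ)`-quasirandom: `H` is `η`-quasirandom relative to `G` on each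
triple of parts, and `G` is `ψ(δ(G))`-quasirandom. -/
def IsQuasirandomChain (H : PartiteThreeGraph X) (G : PartiteGraph Y) (η : ℝ) (ψ : ℝ → ℝ) : Prop :=
  (∀ (i j k : Fin t) (hij : i < j) (hjk : j < k), H.IsQuasirandomOnTriple G η i j k hij hjk) ∧
    G.IsQuasirandom (ψ G.productDensity)

end PartiteThreeGraph

/-- An edge partition of the cylinder `∏ i, Y i`: for all `i < j`, a partition of the complete
bipartite graph `Y i × Y j`. -/
abbrev EdgePartition (Y : ∀ i, Finset (X i)) :=
  ∀ i j : Fin t, i < j → Finpartition (Y i ×ˢ Y j)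

/-- The maximum number of bipartite graphs in one of the partitions of an edge partition. -/
def EdgePartition.size {Y : ∀ i, Finset (X i)} (E : EdgePartition Y) : ℕ :=
  Finset.univ.sup fun p : {p : Fin t × Fin t // p.1 < p.2} => (E p.1.1 p.1.2 p.2).parts.card

/-- A cylinder chain partition: a vertex cylinder partition together with an edge partition of each
of its cylinders. -/
structure CylinderChainPartition (X : Fin t → Type*) [∀ i, DecidableEq (X i)] where
  vertex : VertexCylinderPartition X
  edge : ∀ Y ∈ vertex.parts, EdgePartition Y

namespace CylinderChainPartition

/-- The number of cylinders, `|P_V|`. -/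
def vertexSize (P : CylinderChainPartition X) : ℕ := P.vertex.parts.card

/-- The maximal size of the edge partitions, `|P_E|`. -/
def edgeSize (P : CylinderChainPartition X) : ℕ :=
  P.vertex.parts.attach.sup fun Y => EdgePartition.size (P.edge Y.1 Y.2)

/-- The `t`-partite graph on the cylinder of `x` consisting of the parts of the edge partition which
contain the pairs `(x i, x j)`. -/
noncomputable def graph (P : CylinderChainPartition X) (x : ∀ i, X i) : PartiteGraph (P.vertex.cylinder x) where
  edges i j hij := (P.edge _ (P.vertex.cylinder_mem x) i j hij).part (x i, x j)
  subset i j hij := (P.edge _ (P.vertex.cylinder_mem x) i j hij).part_subset _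

/-- `H` is `(η, ψ)`-quasirandom relative to `P`: for at least a `(1 - η)`-fraction of the tuples `x`,
the chain of `H` determined by `x` is `(η, ψ)`-quasirandom. -/
def IsQuasirandom [∀ i, Fintype (X i)] (P : CylinderChainPartition X) (H : PartiteThreeGraph X)
    (η : ℝ) (ψ : ℝ → ℝ) : Prop :=
  HoldsForFraction (1 - η) fun x => H.IsQuasirandomChain (P.graph x) η ψ

end CylinderChainPartition

end CylinderRegularity

open CylinderRegularity

/-!
# The cylinder regularity lemma for `3`-graphs

The proof is an energy increment in two nested loops. The energy appears as its complement, the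
`residual`: the squared `L²`-distance from a function to the functions constant on the cells of a
partition. A refinement of the partition decreases the residual as soon as a function constant on the
finer cells correlates with the balanced function on the coarser ones (`residual_le_sub`).

*The inner loop* regularises the vertices (`ColoredCylinders.exists_vertex_regular`). If a colour
class of an edge partition is not `c`-quasirandom in some cylinder, then its balanced function
correlates with a product of two of its own sections, so that splitting each side of the cylinder in
two decreases the residual (`exists_bipartite_labels`). Each cylinder is split by its own witnesses,
without common refinements over all cylinders, which keeps their number elementary in the parameters.

*The outer loop* refines the edge partitions (`ColoredCylinders.exists_recolor`). Suppose that the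
`3`-graph is not `η`-quasirandom relative to a triad with quasirandom bipartite graphs and product
density `δ` of the three pairs. The weighted octahedron count of its balanced function `f` is then a
correlation of `f` with the sum, over all faces `b`, of the weights of the octahedra with opposite
faces `b` and `x`; for fixed `b` such a weight is a product of functions of pairs of vertices of `x`
(`octWeight`). By the counting lemma, this sum has `L²`-norm as in a random triad: its square counts
two octahedra with a common face, which consist of `7` edges in each of the three bipartite graphs.
The `3 · 7` errors `2⁻²⁵ δ⁷` of the counting lemma have to be small against `δ⁷`; this is where the
hypothesis `ψ(x) ≤ 2⁻¹⁰⁰ x²⁸` comes from, as the cut norm of a `c ^ 4`-quasirandom function is at most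
`c`. Hence a suitable multiple of the sum gains `η² / 3` relative to the number of triangles, with no
loss in `δ`. By Maurey's sampling argument (`exists_sample`), about `δ⁻²` random faces do as well as
all faces (`exists_octWeight_sample`), and splitting each pair according to its labels with respect
to these faces turns one colour into `2 ^ poly(δ⁻¹)` colours (`exists_triad_labels`).

The potential of the outer loop is at most `t³` per tuple and each round gains `η³ / 6`, so there are
at most `6 t³ / η³ + 1` rounds. In each round, the number of colours grows by boundedly many
exponentials (`colors_growth`). So does the number of cylinders (`cylinders_growth`), because `ψ` cannot
decay too fast at `0`: by Lagrange interpolation at points of `(0, y]`, its value at `η / t²` is at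
most its value at `y` times a power of `1 / y` with exponent `deg ψ` (`eval_le_mul_eval`). This gives
both tower bounds. Finally, colour classes of low density contain few pairs
(`ColoredCylinders.card_lowDensity_le`), so a bound on the number of colours alone yields the lower
bound `δ` on the product density of almost all chains.
-/

namespace CylinderRegularity

/-! ### Averages over the cells of a partition -/

section CellAverage

variable {Ω L L' : Type*} [Fintype Ω]

open scoped Classical in
/-- The cell of `x` in the partition of `Ω` into the fibres of `κ`. -/
noncomputable def cell (κ : Ω → L) (x : Ω) : Finset Ω := {y | κ y = κ x}

/-- The average of `h` over the cell of `x`, that is, the conditional expectation of `h` given `κ`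
with respect to the uniform measure. -/
noncomputable def cellAvg (κ : Ω → L) (h : Ω → ℝ) (x : Ω) : ℝ :=
  (∑ y ∈ cell κ x, h y) / ((cell κ x).card : ℝ)

/-- The squared `L²`-distance (for the counting measure) from `h` to the functions that are constant
on the cells of `κ`. It is the complement of the mean square density, so an energy increment is a
decrease of the residual. -/
noncomputable def residual (κ : Ω → L) (h : Ω → ℝ) : ℝ :=
  ∑ x, (h x - cellAvg κ h x) ^ 2

theorem mem_cell {κ : Ω → L} {x y : Ω} : y ∈ cell κ x ↔ κ y = κ x := by
  simp [cell]

theorem cell_congr {κ : Ω → L} {x y : Ω} (h : κ x = κ y) : cell κ x = cell κ y := by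
  ext z
  rw [mem_cell, mem_cell, h]

theorem cellAvg_congr {κ : Ω → L} (h : Ω → ℝ) {x y : Ω} (hxy : κ x = κ y) :
    cellAvg κ h x = cellAvg κ h y := by
  rw [cellAvg, cellAvg, cell_congr hxy]

theorem card_cell_pos (κ : Ω → L) (x : Ω) : (0 : ℝ) < ((cell κ x).card : ℝ) := by
  exact_mod_cast Finset.card_pos.2 ⟨x, mem_cell.2 rfl⟩

theorem residual_nonneg (κ : Ω → L) (h : Ω → ℝ) : 0 ≤ residual κ h :=
  Finset.sum_nonneg fun _ _ => sq_nonneg _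

/-- The conditional expectation is self-adjoint and fixes the functions constant on cells. -/
theorem sum_mul_cellAvg (κ : Ω → L) (h Ψ : Ω → ℝ) (hΨ : ∀ x y, κ x = κ y → Ψ x = Ψ y) :
    ∑ x, Ψ x * cellAvg κ h x = ∑ x, Ψ x * h x := by
  classical
  have h1 : ∀ x, Ψ x * cellAvg κ h x
      = ∑ y, if κ y = κ x then Ψ y * h y / ((cell κ y).card : ℝ) else 0 := by
    intro x
    rw [cellAvg, Finset.sum_div, Finset.mul_sum, ← Finset.sum_filter]
    refine Finset.sum_congr (by ext y; simp [mem_cell]) fun y hy => ?_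
    have hy' : κ y = κ x := mem_cell.1 hy
    rw [hΨ y x hy', cell_congr hy', mul_div_assoc]
  rw [Finset.sum_congr rfl fun x _ => h1 x, Finset.sum_comm]
  refine Finset.sum_congr rfl fun y _ => ?_
  rw [← Finset.sum_filter, Finset.sum_const, nsmul_eq_mul]
  have h2 : (Finset.univ.filter fun x => κ y = κ x) = cell κ y := by
    ext z
    simp [mem_cell, eq_comm]
  rw [h2, mul_div_cancel₀ _ (card_cell_pos κ y).ne']

theorem sum_cellAvg (κ : Ω → L) (h : Ω → ℝ) : ∑ x, cellAvg κ h x = ∑ x, h x := by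
  simpa using sum_mul_cellAvg κ h (fun _ => 1) fun _ _ _ => rfl

theorem residual_le (κ : Ω → L) (h Ψ : Ω → ℝ) (hΨ : ∀ x y, κ x = κ y → Ψ x = Ψ y) :
    residual κ h ≤ ∑ x, (h x - Ψ x) ^ 2 := by
  have h1 := sum_mul_cellAvg κ h (fun x => cellAvg κ h x - Ψ x)
    fun x y hxy => by rw [cellAvg_congr h hxy, hΨ x y hxy]
  have h2 : ∑ x, (h x - Ψ x) ^ 2 = residual κ h + ∑ x, (cellAvg κ h x - Ψ x) ^ 2 +
      2 * (∑ x, (cellAvg κ h x - Ψ x) * h x - ∑ x, (cellAvg κ h x - Ψ x) * cellAvg κ h x) := by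
    rw [residual, ← Finset.sum_sub_distrib, Finset.mul_sum, ← Finset.sum_add_distrib,
      ← Finset.sum_add_distrib]
    exact Finset.sum_congr rfl fun x _ => by ring
  have h3 : 0 ≤ ∑ x, (cellAvg κ h x - Ψ x) ^ 2 := Finset.sum_nonneg fun _ _ => sq_nonneg _
  rw [h2, h1]
  linarith

theorem residual_le_sum_sq (κ : Ω → L) (h : Ω → ℝ) : residual κ h ≤ ∑ x, h x ^ 2 := by
  simpa using residual_le κ h (fun _ => 0) fun _ _ _ => rfl

theorem residual_mono {κ : Ω → L} {κ' : Ω → L'} (h : Ω → ℝ)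
    (hκ : ∀ x y, κ' x = κ' y → κ x = κ y) : residual κ' h ≤ residual κ h :=
  residual_le κ' h (cellAvg κ h) fun x y hxy => cellAvg_congr h (hκ x y hxy)

/-- The energy increment: a function `Φ` that is constant on the finer cells and correlates with the
balanced function `h - cellAvg κ h` on the coarser cells witnesses a decrease of the residual. -/
theorem residual_le_sub {κ : Ω → L} {κ' : Ω → L'} (h Φ : Ω → ℝ)
    (hκ : ∀ x y, κ' x = κ' y → κ x = κ y) (hΦ : ∀ x y, κ' x = κ' y → Φ x = Φ y) :
    residual κ' h ≤ residual κ h -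
      ∑ x, cellAvg κ (fun y => 2 * (h y - cellAvg κ h y) * Φ y - Φ y ^ 2) x := by
  refine (residual_le κ' h (fun x => cellAvg κ h x + Φ x) fun x y hxy => by
    rw [cellAvg_congr h (hκ x y hxy), hΦ x y hxy]).trans (le_of_eq ?_)
  rw [sum_cellAvg, residual, ← Finset.sum_sub_distrib]
  exact Finset.sum_congr rfl fun x _ => by ring

end CellAverage

/-! ### Sums over product sets -/

section Resampling

variable {ι : Type*} [Fintype ι] [DecidableEq ι] {X : ι → Type*}

open Finset in
theorem sum_piFinset_update (S : ∀ i, Finset (X i)) (i : ι) (G : (∀ i, X i) → ℝ) :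
    ∑ x ∈ Fintype.piFinset S, ∑ u ∈ S i, G (Function.update x i u)
      = (S i).card * ∑ x ∈ Fintype.piFinset S, G x := by
  rw [← Finset.sum_product']
  have : ∑ p ∈ Fintype.piFinset S ×ˢ S i, G (Function.update p.1 i p.2)
      = ∑ p ∈ Fintype.piFinset S ×ˢ S i, G p.1 := by
    refine Finset.sum_nbij' (fun p => (Function.update p.1 i p.2, p.1 i))
      (fun p => (Function.update p.1 i p.2, p.1 i)) ?_ ?_ ?_ ?_ ?_
    · rintro ⟨x, u⟩ h
      simp only [mem_product, Fintype.mem_piFinset] at h ⊢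
      refine ⟨fun j => ?_, h.1 i⟩
      by_cases hj : j = i
      · subst hj; simpa using h.2
      · simpa [hj] using h.1 j
    · rintro ⟨x, u⟩ h
      simp only [mem_product, Fintype.mem_piFinset] at h ⊢
      refine ⟨fun j => ?_, h.1 i⟩
      by_cases hj : j = i
      · subst hj; simpa using h.2
      · simpa [hj] using h.1 j
    · rintro ⟨x, u⟩ _
      simp
    · rintro ⟨x, u⟩ _
      simp
    · rintro ⟨x, u⟩ _
      simp
  rw [this, Finset.sum_product]
  simp [Finset.mul_sum]

theorem sum_piFinset_pair (S : ∀ i, Finset (X i)) {i j : ι} (hij : i ≠ j) (F : X i → X j → ℝ) :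
    ((S i).card * (S j).card : ℝ) * ∑ x ∈ Fintype.piFinset S, F (x i) (x j)
      = (Fintype.piFinset S).card * ∑ u ∈ S i, ∑ v ∈ S j, F u v := by
  rw [mul_assoc, ← sum_piFinset_update S j, ← sum_piFinset_update S i]
  simp [hij, Function.update_of_ne]

theorem sum_piFinset_triple (S : ∀ i, Finset (X i)) {i j k : ι} (hij : i ≠ j) (hik : i ≠ k)
    (hjk : j ≠ k) (F : X i → X j → X k → ℝ) :
    ((S i).card * (S j).card * (S k).card : ℝ) *
        ∑ x ∈ Fintype.piFinset S, F (x i) (x j) (x k)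
      = (Fintype.piFinset S).card * ∑ u ∈ S i, ∑ v ∈ S j, ∑ w ∈ S k, F u v w := by
  rw [mul_assoc, mul_assoc, ← sum_piFinset_update S k, ← sum_piFinset_update S j,
    ← sum_piFinset_update S i]
  simp [hij, hik, hjk, Function.update_of_ne]

end Resampling

/-! ### Quasirandom bipartite graphs -/

section Bipartite

variable {α β : Type*}

open Finset in
/-- The weighted count of four-cycles controls the cut norm, by two applications of the
Cauchy-Schwarz inequality. -/
theorem IsQuasirandomFun.abs_sum_le {A : Finset α} {B : Finset β} {g : α → β → ℝ} {c : ℝ}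
    (hc : 0 ≤ c) (h : IsQuasirandomFun A B g (c ^ 4)) (a : α → ℝ) (b : β → ℝ)
    (ha : ∀ x, |a x| ≤ 1) (hb : ∀ y, |b y| ≤ 1) :
    |∑ x ∈ A, ∑ y ∈ B, g x y * a x * b y| ≤ c * A.card * B.card := by
  set T := ∑ x ∈ A, ∑ y ∈ B, g x y * a x * b y with hT
  set P : α → ℝ := fun x => ∑ y ∈ B, g x y * b y with hP
  set R : β × β → ℝ := fun q => ∑ x ∈ A, g x q.1 * g x q.2 with hR
  have ha2 : ∀ x, a x ^ 2 ≤ 1 := fun x => (sq_le_one_iff_abs_le_one _).2 (ha x)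
  have hb2 : ∀ y, b y ^ 2 ≤ 1 := fun y => (sq_le_one_iff_abs_le_one _).2 (hb y)
  have h1 : T ^ 2 ≤ A.card * ∑ x ∈ A, P x ^ 2 := by
    have : T = ∑ x ∈ A, a x * P x := by
      refine Finset.sum_congr rfl fun x _ => ?_
      rw [hP, Finset.mul_sum]
      exact Finset.sum_congr rfl fun y _ => by ring
    rw [this]
    refine (Finset.sum_mul_sq_le_sq_mul_sq A a P).trans ?_
    refine mul_le_mul_of_nonneg_right ?_ (Finset.sum_nonneg fun _ _ => sq_nonneg _)
    simpa using Finset.sum_le_sum fun x (_ : x ∈ A) => ha2 x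
  have h2 : ∑ x ∈ A, P x ^ 2 = ∑ q ∈ B ×ˢ B, (b q.1 * b q.2) * R q := by
    rw [Finset.sum_product]
    simp only [hP, sq, Finset.sum_mul_sum]
    simp only [hR, Finset.mul_sum]
    rw [Finset.sum_comm]
    refine Finset.sum_congr rfl fun y _ => ?_
    rw [Finset.sum_comm]
    exact Finset.sum_congr rfl fun y' _ => Finset.sum_congr rfl fun x _ => by ring
  have h3 : (∑ x ∈ A, P x ^ 2) ^ 2 ≤ B.card ^ 2 * ∑ q ∈ B ×ˢ B, R q ^ 2 := by
    rw [h2]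
    refine (Finset.sum_mul_sq_le_sq_mul_sq _ _ _).trans ?_
    refine mul_le_mul_of_nonneg_right ?_ (Finset.sum_nonneg fun _ _ => sq_nonneg _)
    have : ∀ q ∈ B ×ˢ B, (b q.1 * b q.2) ^ 2 ≤ 1 := fun q _ => by
      rw [mul_pow]
      exact mul_le_one₀ (hb2 _) (sq_nonneg _) (hb2 _)
    refine (Finset.sum_le_sum this).trans (le_of_eq ?_)
    simp [sq]
  have h4 : ∑ q ∈ B ×ˢ B, R q ^ 2 ≤ c ^ 4 * (A.card : ℝ) ^ 2 * (B.card : ℝ) ^ 2 := by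
    refine le_trans (le_of_eq ?_) h
    rw [Finset.sum_product]
    simp only [hR, sq, Finset.sum_mul_sum]
    rw [Finset.sum_congr rfl fun y _ => Finset.sum_comm, Finset.sum_comm]
    refine Finset.sum_congr rfl fun x _ => ?_
    rw [Finset.sum_congr rfl fun y _ => Finset.sum_comm, Finset.sum_comm]
    exact Finset.sum_congr rfl fun x' _ => Finset.sum_congr rfl fun y _ =>
      Finset.sum_congr rfl fun y' _ => by ring
  have h5 : T ^ 4 ≤ (c * A.card * B.card) ^ 4 := by
    calc T ^ 4 = (T ^ 2) ^ 2 := by ring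
      _ ≤ (A.card * ∑ x ∈ A, P x ^ 2) ^ 2 := pow_le_pow_left₀ (sq_nonneg _) h1 2
      _ = (A.card : ℝ) ^ 2 * (∑ x ∈ A, P x ^ 2) ^ 2 := by ring
      _ ≤ (A.card : ℝ) ^ 2 * (B.card ^ 2 * (c ^ 4 * (A.card : ℝ) ^ 2 * (B.card : ℝ) ^ 2)) := by
        gcongr
        exact h3.trans (by gcongr)
      _ = _ := by ring
  rw [← (show Even 4 by decide).pow_abs] at h5
  exact (pow_le_pow_iff_left₀ (abs_nonneg _) (by positivity) (by norm_num)).1 h5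

/-- If `g` is not quasirandom then it correlates with the product of two of its own sections. -/
theorem exists_correlation_of_not_isQuasirandomFun {A : Finset α} {B : Finset β} {g : α → β → ℝ}
    {c : ℝ} (hc : 0 ≤ c) (hg : ∀ x y, |g x y| ≤ 1) (h : ¬ IsQuasirandomFun A B g c) :
    ∃ x' ∈ A, ∃ y' ∈ B, c ^ 2 * A.card * B.card ≤ ∑ x ∈ A, ∑ y ∈ B,
      (2 * g x y * (c * (g x y' * g x' y * g x' y')) - (c * (g x y' * g x' y * g x' y')) ^ 2) := by
  rw [IsQuasirandomFun, not_le] at h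
  by_contra! hcon
  have key : ∀ x' ∈ A, ∀ y' ∈ B,
      ∑ x ∈ A, ∑ y ∈ B, g x y * g x' y * g x y' * g x' y' ≤ c * A.card * B.card := by
    intro x' hx' y' hy'
    by_contra! h1
    refine absurd (hcon x' hx' y' hy') (not_lt.2 ?_)
    have h2 : ∀ x y, (c * (g x y' * g x' y * g x' y')) ^ 2 ≤ c ^ 2 := fun x y => by
      rw [mul_pow]
      refine mul_le_of_le_one_right (sq_nonneg _) ((sq_le_one_iff_abs_le_one _).2 ?_)
      rw [abs_mul, abs_mul]
      exact mul_le_one₀ (mul_le_one₀ (hg _ _) (abs_nonneg _) (hg _ _)) (abs_nonneg _) (hg _ _)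
    have h3 : ∑ x ∈ A, ∑ y ∈ B,
        (2 * c * (g x y * g x' y * g x y' * g x' y') - c ^ 2) ≤ ∑ x ∈ A, ∑ y ∈ B,
      (2 * g x y * (c * (g x y' * g x' y * g x' y')) - (c * (g x y' * g x' y * g x' y')) ^ 2) :=
      Finset.sum_le_sum fun x _ => Finset.sum_le_sum fun y _ => by
        have := h2 x y
        linarith
    refine le_trans ?_ h3
    simp only [Finset.sum_sub_distrib, ← Finset.mul_sum, Finset.sum_const, nsmul_eq_mul]
    have h4 := mul_le_mul_of_nonneg_left h1.le (by linarith : 0 ≤ 2 * c)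
    linarith
  refine absurd h (not_lt.2 ?_)
  calc _ = ∑ x' ∈ A, ∑ y' ∈ B, ∑ x ∈ A, ∑ y ∈ B, g x y * g x' y * g x y' * g x' y' := by
        rw [Finset.sum_comm]
        refine Finset.sum_congr rfl fun x' _ => ?_
        rw [Finset.sum_congr rfl fun x _ => Finset.sum_comm, Finset.sum_comm]
    _ ≤ ∑ x' ∈ A, ∑ y' ∈ B, c * A.card * B.card :=
        Finset.sum_le_sum fun x' hx' => Finset.sum_le_sum fun y' hy' => key x' hx' y' hy'
    _ = _ := by
        simp only [Finset.sum_const, nsmul_eq_mul]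
        ring

theorem bipDensity_nonneg (A : Finset α) (B : Finset β) (E : Finset (α × β)) :
    0 ≤ bipDensity A B E := by
  unfold bipDensity
  positivity

theorem bipDensity_le_one {A : Finset α} {B : Finset β} {E : Finset (α × β)} (hE : E ⊆ A ×ˢ B) :
    bipDensity A B E ≤ 1 := by
  refine div_le_one_of_le₀ ?_ (by positivity)
  exact_mod_cast (Finset.card_le_card hE).trans_eq (Finset.card_product A B)

theorem abs_indicator_sub_le_one {p : Prop} [Decidable p] {d : ℝ} (h0 : 0 ≤ d) (h1 : d ≤ 1) :
    |(if p then 1 else 0) - d| ≤ 1 := by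
  split_ifs <;> rw [abs_le] <;> constructor <;> linarith

variable [DecidableEq α] [DecidableEq β]

/-- The indicator function of a bipartite graph minus its density. -/
noncomputable def bipBalanced (A : Finset α) (B : Finset β) (E : Finset (α × β)) (x : α) (y : β) :
    ℝ :=
  (if (x, y) ∈ E then 1 else 0) - bipDensity A B E

/-- Failure of quasirandomness of a bipartite graph is witnessed by splitting each of its two parts
into two pieces. -/
theorem exists_bipartite_labels (A : Finset α) (B : Finset β) (E : Finset (α × β)) (c : ℝ) :
    ∃ (p : α → Bool) (q : β → Bool) (φ : Bool → Bool → ℝ), E ⊆ A ×ˢ B → 0 ≤ c →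
      0 ≤ ∑ x ∈ A, ∑ y ∈ B,
        (2 * bipBalanced A B E x y * φ (p x) (q y) - φ (p x) (q y) ^ 2) ∧
      (¬ IsQuasirandomPair A B E c → c ^ 2 * A.card * B.card ≤ ∑ x ∈ A, ∑ y ∈ B,
        (2 * bipBalanced A B E x y * φ (p x) (q y) - φ (p x) (q y) ^ 2)) := by
  by_cases h : E ⊆ A ×ˢ B ∧ 0 ≤ c ∧ ¬ IsQuasirandomPair A B E c
  · obtain ⟨hE, hc, hq⟩ := h
    obtain ⟨x', -, y', -, hxy⟩ := exists_correlation_of_not_isQuasirandomFun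
      (g := bipBalanced A B E) hc (fun x y =>
        abs_indicator_sub_le_one (bipDensity_nonneg _ _ _) (bipDensity_le_one hE)) hq
    refine ⟨fun x => decide ((x, y') ∈ E), fun y => decide ((x', y) ∈ E), fun s s' =>
      c * (((if s then 1 else 0) - bipDensity A B E) * ((if s' then 1 else 0) - bipDensity A B E) *
        bipBalanced A B E x' y'), fun _ _ => ?_⟩
    have : ∀ x y, c * (((if decide ((x, y') ∈ E) then 1 else 0) - bipDensity A B E) *
        ((if decide ((x', y) ∈ E) then 1 else 0) - bipDensity A B E) * bipBalanced A B E x' y')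
        = c * (bipBalanced A B E x y' * bipBalanced A B E x' y * bipBalanced A B E x' y') := by
      intro x y
      simp [bipBalanced]
    simp only [this]
    exact ⟨le_trans (by positivity) hxy, fun _ => hxy⟩
  · refine ⟨fun _ => false, fun _ => false, fun _ _ => 0, fun hE hc => ⟨by simp, fun hq => ?_⟩⟩
    exact absurd ⟨hE, hc, hq⟩ h

end Bipartite

/-! ### Counting in quasirandom graphs -/

section Counting

variable {ι κ : Type*} [Fintype ι] [DecidableEq ι] {X : ι → Type*}

/-- One step of the telescoping in the counting lemma: the edge `e₀` contributes the function `g`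
of small cut norm, and since no edge of `E` joins the two ends of `e₀`, the other factors split
into a function not depending on one end and a function not depending on the other. -/
theorem abs_sum_mul_prod_le (S : ∀ v, Finset (X v)) (src tgt : κ → ι)
    (G : ∀ e, X (src e) → X (tgt e) → ℝ) (hG : ∀ e u v, |G e u v| ≤ 1)
    (hsimple : ∀ e e', (src e = src e' ∨ src e = tgt e') → (tgt e = src e' ∨ tgt e = tgt e') →
      e = e')
    (e₀ : κ) (hne : src e₀ ≠ tgt e₀) (g : X (src e₀) → X (tgt e₀) → ℝ) (c : ℝ)
    (hcut : ∀ (a : X (src e₀) → ℝ) (b : X (tgt e₀) → ℝ), (∀ u, |a u| ≤ 1) → (∀ v, |b v| ≤ 1) →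
      |∑ u ∈ S (src e₀), ∑ v ∈ S (tgt e₀), g u v * a u * b v|
        ≤ c * (S (src e₀)).card * (S (tgt e₀)).card)
    (E : Finset κ) (hE : e₀ ∉ E) :
    |∑ x ∈ Fintype.piFinset S, g (x (src e₀)) (x (tgt e₀)) * ∏ e ∈ E, G e (x (src e)) (x (tgt e))|
      ≤ c * (Fintype.piFinset S).card := by
  classical
  by_cases hS : (Fintype.piFinset S).Nonempty
  swap
  · rw [Finset.not_nonempty_iff_eq_empty.1 hS]
    simp
  have hS' := Fintype.piFinset_nonempty.1 hS
  have hs : (0 : ℝ) < (S (src e₀)).card := by exact_mod_cast Finset.card_pos.2 (hS' _)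
  have ht : (0 : ℝ) < (S (tgt e₀)).card := by exact_mod_cast Finset.card_pos.2 (hS' _)
  set F : (∀ v, X v) → ℝ := fun x =>
    g (x (src e₀)) (x (tgt e₀)) * ∏ e ∈ E, G e (x (src e)) (x (tgt e)) with hF
  set E₁ := E.filter fun e => ¬ (tgt e₀ = src e ∨ tgt e₀ = tgt e) with hE₁
  set E₂ := E.filter fun e => tgt e₀ = src e ∨ tgt e₀ = tgt e with hE₂
  have hfac : ∀ x u v, F (Function.update (Function.update x (src e₀) u) (tgt e₀) v)
      = g u v * (∏ e ∈ E₁, G e (Function.update x (src e₀) u (src e))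
          (Function.update x (src e₀) u (tgt e))) *
        ∏ e ∈ E₂, G e (Function.update x (tgt e₀) v (src e))
          (Function.update x (tgt e₀) v (tgt e)) := by
    intro x u v
    have h1 : ∀ e ∈ E₁, G e (Function.update (Function.update x (src e₀) u) (tgt e₀) v (src e))
        (Function.update (Function.update x (src e₀) u) (tgt e₀) v (tgt e))
        = G e (Function.update x (src e₀) u (src e)) (Function.update x (src e₀) u (tgt e)) := by
      intro e he
      have h := (Finset.mem_filter.1 he).2
      push Not at h
      rw [Function.update_of_ne h.1.symm, Function.update_of_ne h.2.symm]
    have h2 : ∀ e ∈ E₂, G e (Function.update (Function.update x (src e₀) u) (tgt e₀) v (src e))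
        (Function.update (Function.update x (src e₀) u) (tgt e₀) v (tgt e))
        = G e (Function.update x (tgt e₀) v (src e)) (Function.update x (tgt e₀) v (tgt e)) := by
      intro e he
      have h := Finset.mem_filter.1 he
      have h3 : ¬ (src e₀ = src e ∨ src e₀ = tgt e) := fun h3 =>
        hE ((hsimple e₀ e h3 h.2).symm ▸ h.1)
      push Not at h3
      rw [Function.update_comm hne, Function.update_of_ne h3.1.symm,
        Function.update_of_ne h3.2.symm]
    rw [← Finset.prod_congr rfl h1, ← Finset.prod_congr rfl h2, mul_assoc, mul_comm (∏ e ∈ E₁, _),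
      hE₁, hE₂, Finset.prod_filter_mul_prod_filter_not, hF]
    simp [hne]
  have hprod : ∀ (E' : Finset κ) (y : ∀ v, X v), |∏ e ∈ E', G e (y (src e)) (y (tgt e))| ≤ 1 := by
    intro E' y
    rw [Finset.abs_prod]
    exact Finset.prod_le_one (fun _ _ => abs_nonneg _) fun _ _ => hG _ _ _
  have hsum : ((S (src e₀)).card : ℝ) * ((S (tgt e₀)).card * ∑ x ∈ Fintype.piFinset S, F x)
      = ∑ x ∈ Fintype.piFinset S, ∑ u ∈ S (src e₀), ∑ v ∈ S (tgt e₀),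
        F (Function.update (Function.update x (src e₀) u) (tgt e₀) v) := by
    rw [← sum_piFinset_update S (tgt e₀), ← sum_piFinset_update S (src e₀)]
  have hle : ((S (src e₀)).card : ℝ) * ((S (tgt e₀)).card * |∑ x ∈ Fintype.piFinset S, F x|)
      ≤ (S (src e₀)).card * ((S (tgt e₀)).card * (c * (Fintype.piFinset S).card)) := by
    rw [← abs_of_pos hs, ← abs_of_pos ht, ← abs_mul, ← abs_mul, abs_of_pos hs, abs_of_pos ht, hsum]
    refine (Finset.abs_sum_le_sum_abs _ _).trans ?_
    refine (Finset.sum_le_sum fun x _ => ?_ :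
      _ ≤ ∑ x ∈ Fintype.piFinset S, c * (S (src e₀)).card * (S (tgt e₀)).card).trans (le_of_eq ?_)
    · simp only [hfac]
      exact hcut _ _ (fun u => hprod E₁ _) fun v => hprod E₂ _
    · rw [Finset.sum_const, nsmul_eq_mul]
      ring
  exact le_of_mul_le_mul_left (le_of_mul_le_mul_left hle hs) ht

/-- The counting lemma: if each `G e` differs from the constant `d e` by a function of cut norm at
most `c`, then the weighted number of copies of the graph with edge set `E` is as in a random graph,
up to an error `c` for each edge. -/
theorem abs_sum_prod_sub_le (S : ∀ v, Finset (X v)) (src tgt : κ → ι)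
    (G : ∀ e, X (src e) → X (tgt e) → ℝ) (d : κ → ℝ) (c : ℝ)
    (hG : ∀ e u v, |G e u v| ≤ 1) (hd : ∀ e, |d e| ≤ 1) (hne : ∀ e, src e ≠ tgt e)
    (hsimple : ∀ e e', (src e = src e' ∨ src e = tgt e') → (tgt e = src e' ∨ tgt e = tgt e') →
      e = e')
    (hcut : ∀ e (a : X (src e) → ℝ) (b : X (tgt e) → ℝ), (∀ u, |a u| ≤ 1) → (∀ v, |b v| ≤ 1) →
      |∑ u ∈ S (src e), ∑ v ∈ S (tgt e), (G e u v - d e) * a u * b v|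
        ≤ c * (S (src e)).card * (S (tgt e)).card)
    (E : Finset κ) :
    |∑ x ∈ Fintype.piFinset S, ∏ e ∈ E, G e (x (src e)) (x (tgt e))
        - (∏ e ∈ E, d e) * (Fintype.piFinset S).card|
      ≤ E.card * c * (Fintype.piFinset S).card := by
  classical
  induction E using Finset.induction_on with
  | empty => simp
  | insert e₀ E he ih =>
    have h1 := abs_sum_mul_prod_le S src tgt G hG hsimple e₀ (hne e₀) (fun u v => G e₀ u v - d e₀) c
      (hcut e₀) E he
    have h2 : ∑ x ∈ Fintype.piFinset S, ∏ e ∈ insert e₀ E, G e (x (src e)) (x (tgt e))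
        - (∏ e ∈ insert e₀ E, d e) * (Fintype.piFinset S).card
        = ∑ x ∈ Fintype.piFinset S, (G e₀ (x (src e₀)) (x (tgt e₀)) - d e₀) *
            ∏ e ∈ E, G e (x (src e)) (x (tgt e))
          + d e₀ * (∑ x ∈ Fintype.piFinset S, ∏ e ∈ E, G e (x (src e)) (x (tgt e))
            - (∏ e ∈ E, d e) * (Fintype.piFinset S).card) := by
      simp only [Finset.prod_insert he, sub_mul, Finset.sum_sub_distrib, ← Finset.mul_sum]
      ring
    rw [h2, Finset.card_insert_of_notMem he]
    refine (abs_add_le _ _).trans ?_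
    rw [abs_mul]
    have h3 := mul_le_mul (hd e₀) ih (abs_nonneg _) zero_le_one
    push_cast
    linarith

end Counting

/-! ### Sampling -/

/-- Maurey's sampling argument: the average of the family `F` is approximated by the average of `s`
of its members, with an error that decays like `1 / s`. -/
theorem exists_sample {Ω σ : Type*} (T : Finset Ω) {D : Finset σ} (hD : D.Nonempty)
    (F : σ → Ω → ℝ) (r : ℝ) (s : ℕ) (f : Ω → ℝ) :
    ∃ a : Fin s → σ, ∑ x ∈ T, (f x - r * ∑ l, F (a l) x) ^ 2
      ≤ ∑ x ∈ T, (f x - r * s * ((∑ b ∈ D, F b x) / D.card)) ^ 2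
        + r ^ 2 * s * ((∑ b ∈ D, ∑ x ∈ T, F b x ^ 2) / D.card) := by
  have hD' : (0 : ℝ) < D.card := by exact_mod_cast hD.card_pos
  induction s generalizing f with
  | zero => exact ⟨Fin.elim0, by simp⟩
  | succ s ih =>
    set μ : Ω → ℝ := fun x => (∑ b ∈ D, F b x) / D.card with hμ
    set V : ℝ := (∑ b ∈ D, ∑ x ∈ T, F b x ^ 2) / D.card with hV
    obtain ⟨b, -, hb⟩ : ∃ b ∈ D, ∑ x ∈ T, (f x - r * s * μ x - r * F b x) ^ 2
        ≤ ∑ x ∈ T, (f x - r * s * μ x - r * μ x) ^ 2 + r ^ 2 * V := by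
      refine Finset.exists_le_of_sum_le hD ?_
      rw [Finset.sum_const, nsmul_eq_mul, mul_add, Finset.sum_comm, Finset.mul_sum, hV,
        mul_left_comm, mul_div_cancel₀ _ hD'.ne', Finset.sum_comm (s := D) (t := T), Finset.mul_sum,
        ← Finset.sum_add_distrib]
      refine Finset.sum_le_sum fun x _ => ?_
      have h1 : ∑ b ∈ D, F b x = D.card * μ x := by rw [hμ, mul_div_cancel₀ _ hD'.ne']
      have h2 : ∑ b ∈ D, (f x - r * s * μ x - r * F b x) ^ 2
          = D.card * (f x - r * s * μ x) ^ 2 - 2 * r * (f x - r * s * μ x) * ∑ b ∈ D, F b x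
            + r ^ 2 * ∑ b ∈ D, F b x ^ 2 := by
        rw [Finset.mul_sum, Finset.mul_sum, ← nsmul_eq_mul, ← Finset.sum_const,
          ← Finset.sum_sub_distrib, ← Finset.sum_add_distrib]
        exact Finset.sum_congr rfl fun b _ => by ring
      rw [h2, h1]
      have h3 : 0 ≤ (D.card : ℝ) * (r * μ x) ^ 2 :=
        mul_nonneg (Nat.cast_nonneg _) (sq_nonneg _)
      nlinarith
    obtain ⟨a, ha⟩ := ih fun x => f x - r * F b x
    refine ⟨Fin.cons b a, ?_⟩
    simp only [Fin.sum_univ_succ, Fin.cons_zero, Fin.cons_succ]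
    calc _ = ∑ x ∈ T, (f x - r * F b x - r * ∑ l, F (a l) x) ^ 2 :=
          Finset.sum_congr rfl fun x _ => by ring
      _ ≤ ∑ x ∈ T, (f x - r * F b x - r * s * μ x) ^ 2 + r ^ 2 * s * V := ha
      _ = ∑ x ∈ T, (f x - r * s * μ x - r * F b x) ^ 2 + r ^ 2 * s * V := by
          congr 1
          exact Finset.sum_congr rfl fun x _ => by ring
      _ ≤ ∑ x ∈ T, (f x - r * s * μ x - r * μ x) ^ 2 + r ^ 2 * V + r ^ 2 * s * V := by gcongr
      _ = _ := by
          push_cast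
          rw [add_assoc]
          congr 1
          · exact Finset.sum_congr rfl fun x _ => by ring
          · ring

/-! ### Tripartite counts -/

section Tripartite

universe u

variable {α β γ : Type u}

/-- The three vertex types of a tripartite graph as a family. -/
def PartType (α β γ : Type u) : Fin 3 → Type u
  | 0 => α
  | 1 => β
  | 2 => γ

/-- The three vertex sets of a tripartite graph as a family. -/
def partSet (U : Finset α) (V : Finset β) (W : Finset γ) : ∀ p, Finset (PartType α β γ p)
  | 0 => U
  | 1 => V
  | 2 => W

/-- The three coordinates of a triple as a family. -/
def partPoint (x : α × β × γ) : ∀ p, PartType α β γ p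
  | 0 => x.1
  | 1 => x.2.1
  | 2 => x.2.2

/-- The first part of each of the three pairs of parts `(0, 1)`, `(0, 2)`, `(1, 2)`. -/
def pairFst : Fin 3 → Fin 3
  | 0 => 0
  | 1 => 0
  | 2 => 1

/-- The second part of each of the three pairs of parts `(0, 1)`, `(0, 2)`, `(1, 2)`. -/
def pairSnd : Fin 3 → Fin 3
  | 0 => 1
  | 1 => 2
  | 2 => 2

/-- Weights on the three pairs of parts as a family. -/
def pairWeight (a : α → β → ℝ) (b : α → γ → ℝ) (c : β → γ → ℝ) :
    ∀ p, PartType α β γ (pairFst p) → PartType α β γ (pairSnd p) → ℝ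
  | 0 => a
  | 1 => b
  | 2 => c

/-- The three bipartite graphs `A`, `B`, `C` join each vertex of `x` to the vertices of `y` in later
parts. In particular `Linked A B C x x` says that `x` is a triangle. -/
def Linked (A : Finset (α × β)) (B : Finset (α × γ)) (C : Finset (β × γ)) (x y : α × β × γ) :
    Prop :=
  (x.1, y.2.1) ∈ A ∧ (x.1, y.2.2) ∈ B ∧ (x.2.1, y.2.2) ∈ C

theorem sum_piFinset_partSet (U : Finset α) (V : Finset β) (W : Finset γ)
    (F : (∀ v : Fin 3 × Fin 3, PartType α β γ v.1) → ℝ) :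
    ∑ x ∈ Fintype.piFinset (fun v : Fin 3 × Fin 3 => partSet U V W v.1), F x
      = ∑ x ∈ U ×ˢ V ×ˢ W, ∑ y ∈ U ×ˢ V ×ˢ W, ∑ z ∈ U ×ˢ V ×ˢ W,
        F fun v => partPoint (![x, y, z] v.2) v.1 := by
  rw [← Finset.sum_product', ← Finset.sum_product']
  symm
  refine Finset.sum_nbij' (fun q v => partPoint (![q.1.1, q.1.2, q.2] v.2) v.1)
    (fun f => (((f (0, 0), f (1, 0), f (2, 0)), (f (0, 1), f (1, 1), f (2, 1))),
      (f (0, 2), f (1, 2), f (2, 2)))) ?_ ?_ ?_ ?_ ?_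
  · rintro ⟨⟨x, y⟩, z⟩ h
    simp only [Finset.mem_product] at h
    rw [Fintype.mem_piFinset]
    rintro ⟨p, m⟩
    fin_cases p <;> fin_cases m <;> simp only [partPoint, partSet] <;> first
      | exact h.1.1.1 | exact h.1.1.2.1 | exact h.1.1.2.2
      | exact h.1.2.1 | exact h.1.2.2.1 | exact h.1.2.2.2
      | exact h.2.1 | exact h.2.2.1 | exact h.2.2.2
  · intro f h
    rw [Fintype.mem_piFinset] at h
    simp only [Finset.mem_product]
    exact ⟨⟨⟨h (0, 0), h (1, 0), h (2, 0)⟩, h (0, 1), h (1, 1), h (2, 1)⟩,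
      h (0, 2), h (1, 2), h (2, 2)⟩
  · rintro ⟨⟨x, y⟩, z⟩ _
    rfl
  · intro f _
    funext ⟨p, m⟩
    fin_cases p <;> fin_cases m <;> rfl
  · intro _ _
    rfl

variable [DecidableEq α] [DecidableEq β] [DecidableEq γ]

open scoped Classical in
/-- In a tripartite graph with sufficiently quasirandom pairs, the number of copies of a graph on
three vertices per part, prescribed by which of the three triples are linked, is at most slightly
more than expected. -/
theorem sum_linked_le {U : Finset α} {V : Finset β} {W : Finset γ} {A : Finset (α × β)}
    {B : Finset (α × γ)} {C : Finset (β × γ)} (hA : A ⊆ U ×ˢ V) (hB : B ⊆ U ×ˢ W)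
    (hC : C ⊆ V ×ˢ W) {δ : ℝ}
    (hδ : δ = bipDensity U V A * bipDensity U W B * bipDensity V W C)
    (hqA : IsQuasirandomPair U V A (((2 : ℝ)⁻¹ ^ 25 * δ ^ 7) ^ 4))
    (hqB : IsQuasirandomPair U W B (((2 : ℝ)⁻¹ ^ 25 * δ ^ 7) ^ 4))
    (hqC : IsQuasirandomPair V W C (((2 : ℝ)⁻¹ ^ 25 * δ ^ 7) ^ 4))
    (E : Finset (Fin 3 × Fin 3)) (hE : E.card ≤ 7) :
    ∑ x ∈ U ×ˢ V ×ˢ W, ∑ y ∈ U ×ˢ V ×ˢ W, ∑ z ∈ U ×ˢ V ×ˢ W,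
        (if ∀ e ∈ E, Linked A B C (![x, y, z] e.1) (![x, y, z] e.2) then (1 : ℝ) else 0)
      ≤ 1.01 * δ ^ E.card * ((U ×ˢ V ×ˢ W).card : ℝ) ^ 3 := by
  have hA0 := bipDensity_nonneg U V A
  have hB0 := bipDensity_nonneg U W B
  have hC0 := bipDensity_nonneg V W C
  have hA1 := bipDensity_le_one hA
  have hB1 := bipDensity_le_one hB
  have hC1 := bipDensity_le_one hC
  have hδ0 : 0 ≤ δ := by rw [hδ]; positivity
  have hδ1 : δ ≤ 1 := by
    rw [hδ]
    exact mul_le_one₀ (mul_le_one₀ hA1 hB0 hB1) hC0 hC1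
  set c : ℝ := (2 : ℝ)⁻¹ ^ 25 * δ ^ 7 with hc
  have hc0 : 0 ≤ c := by positivity
  set d : Fin 3 → ℝ := ![bipDensity U V A, bipDensity U W B, bipDensity V W C] with hd
  have hind : ∀ (p : Prop) [Decidable p], |(if p then (1 : ℝ) else 0)| ≤ 1 := by
    intro p _
    split_ifs <;> simp
  have key := abs_sum_prod_sub_le (ι := Fin 3 × Fin 3) (κ := Fin 3 × (Fin 3 × Fin 3))
    (X := fun v => PartType α β γ v.1) (fun v => partSet U V W v.1)
    (fun e => (pairFst e.1, e.2.1)) (fun e => (pairSnd e.1, e.2.2))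
    (fun e => pairWeight (fun x y => if (x, y) ∈ A then (1 : ℝ) else 0)
      (fun x y => if (x, y) ∈ B then (1 : ℝ) else 0)
      (fun x y => if (x, y) ∈ C then (1 : ℝ) else 0) e.1) (fun e => d e.1) c
    (by
      rintro ⟨p, e⟩
      fin_cases p <;> exact fun _ _ => hind _)
    (by
      rintro ⟨p, e⟩
      fin_cases p
      · simpa [hd, abs_of_nonneg hA0] using hA1
      · simpa [hd, abs_of_nonneg hB0] using hB1
      · simpa [hd, abs_of_nonneg hC0] using hC1)
    (by
      rintro ⟨p, e⟩
      fin_cases p <;> simp [pairFst, pairSnd])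
    (by decide)
    (by
      rintro ⟨p, e⟩
      fin_cases p
      · exact fun a b ha hb => IsQuasirandomFun.abs_sum_le hc0 hqA a b ha hb
      · exact fun a b ha hb => IsQuasirandomFun.abs_sum_le hc0 hqB a b ha hb
      · exact fun a b ha hb => IsQuasirandomFun.abs_sum_le hc0 hqC a b ha hb)
    (Finset.univ ×ˢ E)
  have hcard : ((Fintype.piFinset fun v : Fin 3 × Fin 3 => partSet U V W v.1).card : ℝ)
      = ((U ×ˢ V ×ˢ W).card : ℝ) ^ 3 := by
    have := sum_piFinset_partSet U V W fun _ => (1 : ℝ)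
    simp only [Finset.sum_const, nsmul_eq_mul, mul_one] at this
    rw [this]
    ring
  have hprod : ∏ e ∈ (Finset.univ : Finset (Fin 3)) ×ˢ E, d e.1 = δ ^ E.card := by
    rw [Finset.prod_product]
    simp [Fin.prod_univ_three, hd, hδ, mul_pow]
  rw [hprod, hcard, sum_piFinset_partSet,
    Finset.card_product (Finset.univ : Finset (Fin 3)) E, Finset.card_univ,
    Fintype.card_fin] at key
  have hsum : ∀ x y z : α × β × γ,
      (if ∀ e ∈ E, Linked A B C (![x, y, z] e.1) (![x, y, z] e.2) then (1 : ℝ) else 0)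
      = ∏ e ∈ (Finset.univ : Finset (Fin 3)) ×ˢ E,
        pairWeight (fun x y => if (x, y) ∈ A then (1 : ℝ) else 0)
          (fun x y => if (x, y) ∈ B then (1 : ℝ) else 0)
          (fun x y => if (x, y) ∈ C then (1 : ℝ) else 0) e.1
          (partPoint (![x, y, z] e.2.1) (pairFst e.1))
          (partPoint (![x, y, z] e.2.2) (pairSnd e.1)) := by
    intro x y z
    rw [Finset.prod_product, Fin.prod_univ_three]
    change _ = (∏ e ∈ E, if ((![x, y, z] e.1).1, (![x, y, z] e.2).2.1) ∈ A then (1 : ℝ) else 0) *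
      (∏ e ∈ E, if ((![x, y, z] e.1).1, (![x, y, z] e.2).2.2) ∈ B then (1 : ℝ) else 0) *
      ∏ e ∈ E, if ((![x, y, z] e.1).2.1, (![x, y, z] e.2).2.2) ∈ C then (1 : ℝ) else 0
    rw [Finset.prod_boole, Finset.prod_boole, Finset.prod_boole]
    rw [ite_zero_mul_ite_zero, ite_zero_mul_ite_zero, mul_one, mul_one]
    by_cases h : ∀ e ∈ E, Linked A B C (![x, y, z] e.1) (![x, y, z] e.2)
    · rw [if_pos h, if_pos ⟨⟨fun e he => (h e he).1, fun e he => (h e he).2.1⟩,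
        fun e he => (h e he).2.2⟩]
    · rw [if_neg h, if_neg fun h' => h fun e he => ⟨h'.1.1 e he, h'.1.2 e he, h'.2 e he⟩]
  simp only [hsum]
  have hle := (abs_le.1 key).2
  have hpow : δ ^ 7 ≤ δ ^ E.card := pow_le_pow_of_le_one hδ0 hδ1 hE
  have hE' : (E.card : ℝ) ≤ 7 := by exact_mod_cast hE
  have herr : ((3 * E.card : ℕ) : ℝ) * c ≤ 0.01 * δ ^ E.card := by
    push_cast
    calc (3 * (E.card : ℝ)) * c ≤ (3 * 7) * c := by gcongr
      _ = 21 * 2⁻¹ ^ 25 * δ ^ 7 := by rw [hc]; ring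
      _ ≤ 0.01 * δ ^ 7 := by gcongr; norm_num
      _ ≤ 0.01 * δ ^ E.card := by gcongr
  have hN : (0 : ℝ) ≤ ((U ×ˢ V ×ˢ W).card : ℝ) ^ 3 := by positivity
  have h1 := mul_le_mul_of_nonneg_right herr hN
  linarith

end Tripartite

/-! ### Triads -/

section Triad

universe u

variable {α β γ : Type u}

/-- The weighted count of octahedra. -/
noncomputable def octSum (U : Finset α) (V : Finset β) (W : Finset γ) (f : α → β → γ → ℝ) : ℝ :=
  ∑ x ∈ U, ∑ x' ∈ U, ∑ y ∈ V, ∑ y' ∈ V, ∑ z ∈ W, ∑ z' ∈ W,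
    f x y z * f x y z' * f x y' z * f x y' z' * f x' y z * f x' y z' * f x' y' z * f x' y' z'

/-- The weight of the octahedron on the opposite faces `b` and `x`, without the factor of the face
`x`. For fixed `b` it is a product of functions of pairs of coordinates of `x`. -/
def octWeight (f : α → β → γ → ℝ) (b x : α × β × γ) : ℝ :=
  f b.1 b.2.1 b.2.2 * (f x.1 x.2.1 b.2.2 * f x.1 b.2.1 b.2.2) *
    (f x.1 b.2.1 x.2.2 * f b.1 b.2.1 x.2.2) * (f b.1 x.2.1 x.2.2 * f b.1 x.2.1 b.2.2)

theorem octSum_eq (U : Finset α) (V : Finset β) (W : Finset γ) (f : α → β → γ → ℝ) :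
    octSum U V W f = ∑ x ∈ U ×ˢ V ×ˢ W, ∑ b ∈ U ×ˢ V ×ˢ W, f x.1 x.2.1 x.2.2 * octWeight f b x := by
  simp only [octSum, Finset.sum_product]
  refine Finset.sum_congr rfl fun x _ => ?_
  rw [Finset.sum_comm]
  refine Finset.sum_congr rfl fun y _ => ?_
  rw [Finset.sum_congr rfl fun x' _ => Finset.sum_comm, Finset.sum_comm]
  refine Finset.sum_congr rfl fun z _ => Finset.sum_congr rfl fun x' _ =>
    Finset.sum_congr rfl fun y' _ => Finset.sum_congr rfl fun z' _ => ?_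
  simp only [octWeight]
  ring

variable [DecidableEq α] [DecidableEq β] [DecidableEq γ]

/-- The triangles of the tripartite graph with bipartite graphs `A`, `B`, `C`. -/
def triad (U : Finset α) (V : Finset β) (W : Finset γ) (A : Finset (α × β)) (B : Finset (α × γ))
    (C : Finset (β × γ)) : Finset (α × β × γ) :=
  (U ×ˢ V ×ˢ W).filter fun v => (v.1, v.2.1) ∈ A ∧ (v.1, v.2.2) ∈ B ∧ (v.2.1, v.2.2) ∈ C

/-- The numerical optimisation in the sampling argument: `D`, `S₄`, `S₇` stand for the numbers of
triangles, octahedra, and pairs of octahedra with a common face, and `O` for the correlation. -/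
theorem sample_gain_le {δ N D η s S₄ S₇ O : ℝ} (hδ : 0 < δ) (hN : 0 < N) (hη : 0 < η)
    (hs : 1 ≤ δ ^ 2 * s) (h₁ : D ≤ 1.01 * δ * N) (h₄ : S₄ ≤ 1.01 * δ ^ 4 * N ^ 2) (h₄' : 0 ≤ S₄)
    (h₇ : S₇ ≤ 1.01 * δ ^ 7 * N ^ 3) (hO : η * δ ^ 4 * N ^ 2 ≤ O) :
    η ^ 2 / 3 * D ≤ 2 * (η / (2 * δ ^ 3 * N)) * O - (η / (2 * δ ^ 3 * N)) ^ 2 * S₇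
      - (η / (2 * δ ^ 3 * N)) ^ 2 * (D / s * S₄) := by
  have hs0 : 0 < s := by
    by_contra h
    nlinarith [sq_nonneg δ]
  have h4 : D / s ≤ 1.01 * δ ^ 3 * N := by
    rw [div_le_iff₀ hs0]
    refine h₁.trans ?_
    have := mul_le_mul_of_nonneg_left hs (by positivity : 0 ≤ 1.01 * δ * N)
    linarith
  have h5 : D / s * S₄ ≤ 1.01 * δ ^ 3 * N * (1.01 * δ ^ 4 * N ^ 2) :=
    mul_le_mul h4 h₄ h₄' (by positivity)
  have h6 : (η / (2 * δ ^ 3 * N)) ^ 2 * (S₇ + D / s * S₄)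
      ≤ (η / (2 * δ ^ 3 * N)) ^ 2 * (2.04 * δ ^ 7 * N ^ 3) := by
    refine mul_le_mul_of_nonneg_left ?_ (sq_nonneg _)
    have : 0 ≤ δ ^ 7 * N ^ 3 := by positivity
    linarith
  have h7 : (η / (2 * δ ^ 3 * N)) ^ 2 * (2.04 * δ ^ 7 * N ^ 3) = 0.51 * (η ^ 2 * δ * N) := by
    field_simp
    norm_num
  have h8 : η ^ 2 * δ * N ≤ 2 * (η / (2 * δ ^ 3 * N)) * O := by
    refine le_trans (le_of_eq ?_) (mul_le_mul_of_nonneg_left hO (by positivity))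
    field_simp
  have h9 : η ^ 2 / 3 * D ≤ 0.49 * (η ^ 2 * δ * N) := by
    refine (mul_le_mul_of_nonneg_left h₁ (by positivity)).trans ?_
    have : 0 ≤ η ^ 2 * δ * N := by positivity
    linarith
  linarith

/-- A large weighted count of octahedra of a function supported on the triangles of a quasirandom
tripartite graph is witnessed by a bounded number `s` of faces: the weights of the octahedra on these
faces, suitably normalised, correlate with `f`. The normalisation comes from optimising over the
multiple of the average weight; the count with seven linked pairs bounds its `L²`-norm. -/
theorem exists_octWeight_sample {U : Finset α} {V : Finset β} {W : Finset γ} {A : Finset (α × β)}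
    {B : Finset (α × γ)} {C : Finset (β × γ)} (hA : A ⊆ U ×ˢ V) (hB : B ⊆ U ×ˢ W)
    (hC : C ⊆ V ×ˢ W) {δ : ℝ}
    (hδ : δ = bipDensity U V A * bipDensity U W B * bipDensity V W C) (hδ0 : 0 < δ)
    (hqA : IsQuasirandomPair U V A (((2 : ℝ)⁻¹ ^ 25 * δ ^ 7) ^ 4))
    (hqB : IsQuasirandomPair U W B (((2 : ℝ)⁻¹ ^ 25 * δ ^ 7) ^ 4))
    (hqC : IsQuasirandomPair V W C (((2 : ℝ)⁻¹ ^ 25 * δ ^ 7) ^ 4))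
    {f : α → β → γ → ℝ} (hf : ∀ x y z, |f x y z| ≤ 1)
    (hsupp : ∀ x y z, f x y z ≠ 0 → (x, y, z) ∈ triad U V W A B C)
    {η : ℝ} (hη : 0 < η) (s : ℕ) (hs : 1 ≤ δ ^ 2 * s)
    (hoct : η * δ ^ 4 * ((U ×ˢ V ×ˢ W).card : ℝ) ^ 2 < octSum U V W f) :
    ∃ (a : Fin s → α × β × γ) (r : ℝ), η ^ 2 / 3 * (triad U V W A B C).card
      ≤ ∑ x ∈ U ×ˢ V ×ˢ W, (2 * f x.1 x.2.1 x.2.2 * (r * ∑ l, octWeight f (a l) x)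
        - (r * ∑ l, octWeight f (a l) x) ^ 2) := by
  classical
  set T := U ×ˢ V ×ˢ W with hT
  set Δ := triad U V W A B C with hΔ
  set N : ℝ := (T.card : ℝ) with hN
  have hlink : ∀ x y z, f x y z ≠ 0 → (x, y) ∈ A ∧ (x, z) ∈ B ∧ (y, z) ∈ C := fun x y z h =>
    (Finset.mem_filter.1 (hsupp x y z h)).2
  have hw : ∀ b x, |octWeight f b x|
      ≤ if Linked A B C x x ∧ Linked A B C x b ∧ Linked A B C b x ∧ Linked A B C b b then 1
        else 0 := by
    intro b x
    split_ifs with h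
    · simp only [octWeight, abs_mul]
      have := fun x y z => abs_nonneg (f x y z)
      have h2 : ∀ x y z x' y' z', |f x y z| * |f x' y' z'| ≤ 1 := fun x y z x' y' z' =>
        mul_le_one₀ (hf _ _ _) (abs_nonneg _) (hf _ _ _)
      refine mul_le_one₀ (mul_le_one₀ (mul_le_one₀ (hf _ _ _) ?_ (h2 _ _ _ _ _ _)) ?_
        (h2 _ _ _ _ _ _)) ?_ (h2 _ _ _ _ _ _) <;> positivity
    · rw [abs_nonpos_iff]
      by_contra hne
      simp only [octWeight, mul_ne_zero_iff] at hne
      obtain ⟨⟨⟨h1, h2, h3⟩, h4, h5⟩, h6, h7⟩ := hne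
      have := hlink _ _ _ h1
      have := hlink _ _ _ h2
      have := hlink _ _ _ h3
      have := hlink _ _ _ h4
      have := hlink _ _ _ h5
      have := hlink _ _ _ h6
      have := hlink _ _ _ h7
      exact h (by simp only [Linked]; tauto)
  have hsum : ∀ x, ∑ b ∈ T, octWeight f b x = ∑ b ∈ Δ, octWeight f b x := by
    intro x
    refine (Finset.sum_subset (Finset.filter_subset _ _) fun b _ hb => ?_).symm
    have : f b.1 b.2.1 b.2.2 = 0 := by
      by_contra h
      exact hb (hsupp _ _ _ h)
    simp [octWeight, this]
  have hoct' : octSum U V W f = ∑ x ∈ T, f x.1 x.2.1 x.2.2 * ∑ b ∈ Δ, octWeight f b x := by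
    rw [octSum_eq]
    exact Finset.sum_congr rfl fun x _ => by rw [← Finset.mul_sum, hsum]
  have hpos : 0 < octSum U V W f := lt_of_le_of_lt (by positivity) hoct
  have hΔne : Δ.Nonempty := by
    by_contra h
    rw [Finset.not_nonempty_iff_eq_empty.1 h] at hoct'
    simp [hoct'] at hpos
  have hD : (0 : ℝ) < Δ.card := by exact_mod_cast hΔne.card_pos
  have hN0 : 0 < N := by
    have : Δ.card ≤ T.card := Finset.card_le_card (Finset.filter_subset _ _)
    exact hD.trans_le (Nat.cast_le.2 this)
  have hcount := sum_linked_le hA hB hC hδ hqA hqB hqC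
  have c1 : (Δ.card : ℝ) ≤ 1.01 * δ * N := by
    have h := hcount {(0, 0)} (by simp)
    simp only [Finset.mem_singleton, forall_eq, Matrix.cons_val_zero, Finset.sum_const,
      nsmul_eq_mul, Finset.card_singleton, pow_one, ← Finset.mul_sum, ← hT, ← hN] at h
    rw [← Finset.sum_filter, Finset.sum_const, nsmul_eq_mul, mul_one] at h
    have h' : (T.filter fun x => Linked A B C x x).card = Δ.card := by
      rw [hΔ, triad]
      refine congrArg _ (Finset.filter_congr fun x _ => Iff.rfl)
    rw [h'] at h
    have : N ^ 2 * Δ.card ≤ N ^ 2 * (1.01 * δ * N) := by linarith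
    exact le_of_mul_le_mul_left this (by positivity)
  have c4 : ∑ b ∈ Δ, ∑ x ∈ T, octWeight f b x ^ 2 ≤ 1.01 * δ ^ 4 * N ^ 2 := by
    have h := hcount {(0, 0), (0, 1), (1, 0), (1, 1)} (by decide)
    rw [show ({(0, 0), (0, 1), (1, 0), (1, 1)} : Finset (Fin 3 × Fin 3)).card = 4 by decide] at h
    simp only [Finset.mem_insert, Finset.mem_singleton, forall_eq_or_imp, forall_eq,
      Matrix.cons_val_zero, Matrix.cons_val_one, Finset.sum_const, nsmul_eq_mul, ← Finset.mul_sum,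
      ← hT, ← hN] at h
    have h2 : N * ∑ b ∈ Δ, ∑ x ∈ T, octWeight f b x ^ 2 ≤ N * (1.01 * δ ^ 4 * N ^ 2) := by
      refine le_trans ?_ (h.trans_eq (by ring))
      refine mul_le_mul_of_nonneg_left ?_ hN0.le
      rw [Finset.sum_comm]
      refine Finset.sum_le_sum fun x _ => ?_
      refine (Finset.sum_le_sum fun b _ => ?_).trans (Finset.sum_le_sum_of_subset_of_nonneg
        (Finset.filter_subset _ _) fun b _ _ => by split_ifs <;> norm_num)
      rw [← sq_abs]
      have h3 := hw b x
      have h4 : |octWeight f b x| ≤ 1 := h3.trans (by split_ifs <;> norm_num)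
      exact le_trans (by nlinarith [abs_nonneg (octWeight f b x)]) h3
    exact le_of_mul_le_mul_left h2 hN0
  have c7 : ∑ x ∈ T, (∑ b ∈ Δ, octWeight f b x) ^ 2 ≤ 1.01 * δ ^ 7 * N ^ 3 := by
    have h := hcount {(0, 0), (0, 1), (1, 0), (1, 1), (0, 2), (2, 0), (2, 2)} (by decide)
    rw [show ({(0, 0), (0, 1), (1, 0), (1, 1), (0, 2), (2, 0), (2, 2)} :
      Finset (Fin 3 × Fin 3)).card = 7 by decide] at h
    simp only [Finset.mem_insert, Finset.mem_singleton, forall_eq_or_imp, forall_eq,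
      Matrix.cons_val_zero, Matrix.cons_val_one, Matrix.cons_val, ← hT, ← hN] at h
    refine le_trans (Finset.sum_le_sum fun x _ => ?_) h
    rw [← hsum, sq, Finset.sum_mul_sum]
    refine Finset.sum_le_sum fun b _ => Finset.sum_le_sum fun c _ => ?_
    refine (le_abs_self _).trans ?_
    rw [abs_mul]
    refine (mul_le_mul (hw b x) (hw c x) (abs_nonneg _)
      (by split_ifs <;> norm_num)).trans ?_
    rw [ite_zero_mul_ite_zero, mul_one]
    split_ifs with h1 h2
    · exact le_rfl
    · exact absurd (by tauto) h2
    · exact zero_le_one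
    · exact le_rfl
  have hs0 : (0 : ℝ) < s := by
    by_contra h
    nlinarith [sq_nonneg δ]
  set ρ : ℝ := η / (2 * δ ^ 3 * N) with hρ
  obtain ⟨a, ha⟩ := exists_sample T hΔne (fun b x => octWeight f b x) (ρ * Δ.card / s) s
    fun x => f x.1 x.2.1 x.2.2
  refine ⟨a, ρ * Δ.card / s, ?_⟩
  set r : ℝ := ρ * Δ.card / s with hr
  have h1 : ∑ x ∈ T, (f x.1 x.2.1 x.2.2 - r * s * ((∑ b ∈ Δ, octWeight f b x) / Δ.card)) ^ 2
      = ∑ x ∈ T, f x.1 x.2.1 x.2.2 ^ 2 - 2 * ρ * octSum U V W f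
        + ρ ^ 2 * ∑ x ∈ T, (∑ b ∈ Δ, octWeight f b x) ^ 2 := by
    rw [hoct', Finset.mul_sum, Finset.mul_sum, ← Finset.sum_sub_distrib, ← Finset.sum_add_distrib]
    refine Finset.sum_congr rfl fun x _ => ?_
    rw [hr]
    field_simp
    ring
  have h2 : r ^ 2 * s * ((∑ b ∈ Δ, ∑ x ∈ T, octWeight f b x ^ 2) / Δ.card)
      = ρ ^ 2 * (Δ.card / s * ∑ b ∈ Δ, ∑ x ∈ T, octWeight f b x ^ 2) := by
    rw [hr]
    field_simp
  have h3 : ∑ x ∈ T, (2 * f x.1 x.2.1 x.2.2 * (r * ∑ l, octWeight f (a l) x)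
        - (r * ∑ l, octWeight f (a l) x) ^ 2)
      = ∑ x ∈ T, f x.1 x.2.1 x.2.2 ^ 2
        - ∑ x ∈ T, (f x.1 x.2.1 x.2.2 - r * ∑ l, octWeight f (a l) x) ^ 2 := by
    rw [← Finset.sum_sub_distrib]
    exact Finset.sum_congr rfl fun x _ => by ring
  have h4 := sample_gain_le hδ0 hN0 hη hs c1 c4 (Finset.sum_nonneg fun _ _ =>
    Finset.sum_nonneg fun _ _ => sq_nonneg _) c7 hoct.le
  rw [← hρ] at h4
  rw [h1, h2] at ha
  rw [h3]
  linarith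

end Triad

/-! ### Irregular triads -/

section IrregularTriad

universe u

variable {α β γ : Type u}

/-- The value of the balanced function of a `3`-graph of relative density `d` at a triple, from
whether the triple is a triangle and whether it is an edge. -/
def faceValue (d : ℝ) (b : Bool × Bool) : ℝ :=
  if b.1 then (if b.2 then 1 else 0) - d else 0

theorem abs_faceValue_le_one {d : ℝ} (h0 : 0 ≤ d) (h1 : d ≤ 1) (b : Bool × Bool) :
    |faceValue d b| ≤ 1 := by
  rw [faceValue]
  split_ifs
  · rw [abs_le]; constructor <;> linarith
  · rw [abs_le]; constructor <;> linarith
  · simp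

/-- The labels which `s` faces of octahedra induce on a pair of vertices: for each face, the pair
forms two triples with vertices of the face, and each of these may or may not be a triangle, and may
or may not be an edge. -/
abbrev PairLabel (s : ℕ) : Type :=
  Fin s → (Bool × Bool) × (Bool × Bool)

/-- The relative density of the `3`-graph `h` in the set `Δ` of triples. -/
noncomputable def triadDensity (Δ : Finset (α × β × γ)) (h : α → β → γ → Prop)
    [∀ x y z, Decidable (h x y z)] : ℝ :=
  ((Δ.filter fun v => h v.1 v.2.1 v.2.2).card : ℝ) / (Δ.card : ℝ)

theorem triadDensity_nonneg (Δ : Finset (α × β × γ)) (h : α → β → γ → Prop)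
    [∀ x y z, Decidable (h x y z)] : 0 ≤ triadDensity Δ h := by
  unfold triadDensity
  positivity

theorem triadDensity_le_one (Δ : Finset (α × β × γ)) (h : α → β → γ → Prop)
    [∀ x y z, Decidable (h x y z)] : triadDensity Δ h ≤ 1 :=
  div_le_one_of_le₀ (Nat.cast_le.2 (Finset.card_filter_le _ _)) (Nat.cast_nonneg _)

variable [DecidableEq α] [DecidableEq β] [DecidableEq γ]

/-- The function `1_Δ (1_h - d)`, where `d` is the relative density of `h` in `Δ`. -/
noncomputable def triadBalanced (Δ : Finset (α × β × γ)) (h : α → β → γ → Prop)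
    [∀ x y z, Decidable (h x y z)] (x : α) (y : β) (z : γ) : ℝ :=
  if (x, y, z) ∈ Δ then (if h x y z then 1 else 0) - triadDensity Δ h else 0

theorem triadBalanced_eq (Δ : Finset (α × β × γ)) (h : α → β → γ → Prop)
    [∀ x y z, Decidable (h x y z)] (x : α) (y : β) (z : γ) :
    triadBalanced Δ h x y z
      = faceValue (triadDensity Δ h) (decide ((x, y, z) ∈ Δ), decide (h x y z)) := by
  simp [triadBalanced, faceValue]

/-- The product of the three densities of a triad. -/
noncomputable def triadProduct (U : Finset α) (V : Finset β) (W : Finset γ) (A : Finset (α × β))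
    (B : Finset (α × γ)) (C : Finset (β × γ)) : ℝ :=
  bipDensity U V A * bipDensity U W B * bipDensity V W C

/-- The triad of `A`, `B`, `C` is quasirandom and of product density at least `s ^ (-1/2)`, but the
`3`-graph `h` is not `η`-quasirandom relative to it. -/
def IsIrregularTriad (U : Finset α) (V : Finset β) (W : Finset γ) (A : Finset (α × β))
    (B : Finset (α × γ)) (C : Finset (β × γ)) (h : α → β → γ → Prop)
    [∀ x y z, Decidable (h x y z)] (η : ℝ) (s : ℕ) : Prop :=
  0 < triadProduct U V W A B C ∧ 1 ≤ triadProduct U V W A B C ^ 2 * s ∧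
  IsQuasirandomPair U V A (((2 : ℝ)⁻¹ ^ 25 * triadProduct U V W A B C ^ 7) ^ 4) ∧
  IsQuasirandomPair U W B (((2 : ℝ)⁻¹ ^ 25 * triadProduct U V W A B C ^ 7) ^ 4) ∧
  IsQuasirandomPair V W C (((2 : ℝ)⁻¹ ^ 25 * triadProduct U V W A B C ^ 7) ^ 4) ∧
  η * triadProduct U V W A B C ^ 4 * ((U ×ˢ V ×ˢ W).card : ℝ) ^ 2
    < octSum U V W (triadBalanced (triad U V W A B C) h)

/-- Irregularity of a triad is witnessed by splitting each of its bipartite graphs into a bounded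
number of pieces. -/
theorem exists_triad_labels (U : Finset α) (V : Finset β) (W : Finset γ) (A : Finset (α × β))
    (B : Finset (α × γ)) (C : Finset (β × γ)) (h : α → β → γ → Prop)
    [∀ x y z, Decidable (h x y z)] (η : ℝ) (s : ℕ) :
    ∃ (p : α → β → PairLabel s) (q : α → γ → PairLabel s) (r : β → γ → PairLabel s)
      (φ : PairLabel s → PairLabel s → PairLabel s → ℝ),
      A ⊆ U ×ˢ V → B ⊆ U ×ˢ W → C ⊆ V ×ˢ W → 0 < η →
      0 ≤ ∑ v ∈ triad U V W A B C, (2 * triadBalanced (triad U V W A B C) h v.1 v.2.1 v.2.2 *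
          φ (p v.1 v.2.1) (q v.1 v.2.2) (r v.2.1 v.2.2)
          - φ (p v.1 v.2.1) (q v.1 v.2.2) (r v.2.1 v.2.2) ^ 2) ∧
      (IsIrregularTriad U V W A B C h η s → η ^ 2 / 3 * (triad U V W A B C).card ≤
        ∑ v ∈ triad U V W A B C, (2 * triadBalanced (triad U V W A B C) h v.1 v.2.1 v.2.2 *
          φ (p v.1 v.2.1) (q v.1 v.2.2) (r v.2.1 v.2.2)
          - φ (p v.1 v.2.1) (q v.1 v.2.2) (r v.2.1 v.2.2) ^ 2)) := by
  by_cases hcase : A ⊆ U ×ˢ V ∧ B ⊆ U ×ˢ W ∧ C ⊆ V ×ˢ W ∧ 0 < η ∧ IsIrregularTriad U V W A B C h η s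
  swap
  · exact ⟨fun _ _ _ => ((false, false), (false, false)), fun _ _ _ => ((false, false), (false, false)),
      fun _ _ _ => ((false, false), (false, false)), fun _ _ _ => 0, fun hA hB hC hη =>
        ⟨by simp, fun hirr => absurd ⟨hA, hB, hC, hη, hirr⟩ hcase⟩⟩
  obtain ⟨hA, hB, hC, hη, hδ0, hs, hqA, hqB, hqC, hoct⟩ := hcase
  set Δ := triad U V W A B C with hΔ
  set d := triadDensity Δ h with hd
  have hd0 : 0 ≤ d := triadDensity_nonneg _ _
  have hd1 : d ≤ 1 := triadDensity_le_one _ _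
  set f := triadBalanced Δ h with hf
  have hf1 : ∀ x y z, |f x y z| ≤ 1 := fun x y z => by
    rw [hf, triadBalanced_eq]
    exact abs_faceValue_le_one hd0 hd1 _
  have hsupp : ∀ x y z, f x y z ≠ 0 → (x, y, z) ∈ Δ := fun x y z hne => by
    by_contra hnot
    exact hne (if_neg hnot)
  obtain ⟨a, ρ, ha⟩ := exists_octWeight_sample hA hB hC rfl hδ0 hqA hqB hqC hf1 hsupp hη s hs hoct
  let lab : α → β → γ → Bool × Bool := fun x y z => (decide ((x, y, z) ∈ Δ), decide (h x y z))
  have hlab : ∀ x y z, f x y z = faceValue d (lab x y z) := fun x y z => triadBalanced_eq Δ h x y z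
  let p : α → β → PairLabel s := fun x y l => (lab x y (a l).2.2, lab x (a l).2.1 (a l).2.2)
  let q : α → γ → PairLabel s := fun x z l => (lab x (a l).2.1 z, lab (a l).1 (a l).2.1 z)
  let r : β → γ → PairLabel s := fun y z l => (lab (a l).1 y z, lab (a l).1 y (a l).2.2)
  let val : PairLabel s → Fin s → ℝ := fun b l => faceValue d (b l).1 * faceValue d (b l).2
  let φ : PairLabel s → PairLabel s → PairLabel s → ℝ := fun b₁ b₂ b₃ =>
    ρ * ∑ l, f (a l).1 (a l).2.1 (a l).2.2 * val b₁ l * val b₂ l * val b₃ l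
  have hφ : ∀ v : α × β × γ, φ (p v.1 v.2.1) (q v.1 v.2.2) (r v.2.1 v.2.2)
      = ρ * ∑ l, octWeight f (a l) v := by
    intro v
    simp only [φ, val, p, q, r, octWeight, hlab]
  have key : η ^ 2 / 3 * Δ.card ≤ ∑ v ∈ Δ, (2 * f v.1 v.2.1 v.2.2 *
          φ (p v.1 v.2.1) (q v.1 v.2.2) (r v.2.1 v.2.2)
          - φ (p v.1 v.2.1) (q v.1 v.2.2) (r v.2.1 v.2.2) ^ 2) := by
    simp only [hφ]
    refine ha.trans ?_
    rw [← Finset.sum_sdiff (Finset.filter_subset _ _ : Δ ⊆ U ×ˢ V ×ˢ W)]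
    have : ∑ x ∈ (U ×ˢ V ×ˢ W) \ Δ, (2 * f x.1 x.2.1 x.2.2 * (ρ * ∑ l, octWeight f (a l) x)
        - (ρ * ∑ l, octWeight f (a l) x) ^ 2) ≤ 0 := by
      refine Finset.sum_nonpos fun x hx => ?_
      have : f x.1 x.2.1 x.2.2 = 0 := if_neg (Finset.mem_sdiff.1 hx).2
      rw [this, mul_zero, zero_mul, zero_sub]
      exact neg_nonpos.2 (sq_nonneg _)
    exact add_le_of_nonpos_left this
  exact ⟨p, q, r, φ, fun _ _ _ _ => ⟨le_trans (by positivity) key, fun _ => key⟩⟩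

end IrregularTriad

/-! ### Coloured cylinder partitions -/

universe u

variable {t : ℕ} {X : Fin t → Type u}

/-- A cylinder chain partition in functional form: `cyl x` is the cylinder of the tuple `x`, and the
edge partitions of this cylinder are given by colourings `col x i j` of pairs with `M` colours; both
depend only on the cylinder. This form is easy to refine: restricting to a smaller cylinder keeps the
colouring, and refining an edge partition is pairing colours with labels. -/
structure ColoredCylinders (X : Fin t → Type u) (M : ℕ) where
  cyl : (∀ i, X i) → ∀ i, Finset (X i)
  col : (∀ i, X i) → ∀ i j, X i → X j → Fin M
  mem_cyl : ∀ x i, x i ∈ cyl x i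
  cyl_eq : ∀ x y, (∀ i, y i ∈ cyl x i) → cyl y = cyl x
  col_eq : ∀ x y, (∀ i, y i ∈ cyl x i) → col y = col x

namespace ColoredCylinders

variable {M : ℕ} (S : ColoredCylinders X M)

theorem mem_of_cyl_eq {x y : ∀ i, X i} (h : S.cyl y = S.cyl x) (i : Fin t) : y i ∈ S.cyl x i :=
  h ▸ S.mem_cyl y i

theorem col_congr {x y : ∀ i, X i} (h : S.cyl y = S.cyl x) : S.col y = S.col x :=
  S.col_eq x y (S.mem_of_cyl_eq h)

/-- The pairs of colour `a` between the sides `i` and `j` of the cylinder of `x`. -/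
def edges (x : ∀ i, X i) (i j : Fin t) (a : Fin M) : Finset (X i × X j) :=
  (S.cyl x i ×ˢ S.cyl x j).filter fun p => S.col x i j p.1 p.2 = a

theorem edges_subset (x : ∀ i, X i) (i j : Fin t) (a : Fin M) :
    S.edges x i j a ⊆ S.cyl x i ×ˢ S.cyl x j :=
  Finset.filter_subset _ _

theorem edges_congr {x y : ∀ i, X i} (h : S.cyl y = S.cyl x) : S.edges y = S.edges x := by
  funext i j a
  rw [edges, edges, h, S.col_congr h]

/-- The density of the pairs of colour `a` between the sides `i` and `j` of the cylinder of `x`. -/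
noncomputable def dens (x : ∀ i, X i) (i j : Fin t) (a : Fin M) : ℝ :=
  bipDensity (S.cyl x i) (S.cyl x j) (S.edges x i j a)

theorem card_cyl_pos (x : ∀ i, X i) (i : Fin t) : (0 : ℝ) < (S.cyl x i).card := by
  exact_mod_cast Finset.card_pos.2 ⟨x i, S.mem_cyl x i⟩

/-! ### Splitting the vertices -/

/-- Split the sides of each cylinder according to labels of the vertices. -/
def splitVertices {Λ : Type*} [DecidableEq Λ] (lab : (∀ i, X i) → ∀ i, X i → Λ)
    (hlab : ∀ x y, S.cyl y = S.cyl x → lab y = lab x) : ColoredCylinders X M where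
  cyl x i := (S.cyl x i).filter fun u => lab x i u = lab x i (x i)
  col := S.col
  mem_cyl x i := Finset.mem_filter.2 ⟨S.mem_cyl x i, rfl⟩
  cyl_eq x y h := by
    have h1 : S.cyl y = S.cyl x := S.cyl_eq x y fun i => (Finset.mem_filter.1 (h i)).1
    funext i
    rw [h1, hlab x y h1, (Finset.mem_filter.1 (h i)).2]
  col_eq x y h := S.col_eq x y fun i => (Finset.mem_filter.1 (h i)).1

section

variable {Λ : Type*} [DecidableEq Λ] (lab : (∀ i, X i) → ∀ i, X i → Λ)
    (hlab : ∀ x y, S.cyl y = S.cyl x → lab y = lab x)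

theorem splitVertices_cyl_eq {x y : ∀ i, X i}
    (h : (S.splitVertices lab hlab).cyl x = (S.splitVertices lab hlab).cyl y) :
    S.cyl x = S.cyl y ∧ ∀ i, lab x i (x i) = lab y i (y i) := by
  have h1 := fun i => Finset.mem_filter.1 ((S.splitVertices lab hlab).mem_of_cyl_eq h i)
  have h2 : S.cyl x = S.cyl y := S.cyl_eq y x fun i => (h1 i).1
  exact ⟨h2, fun i => by rw [hlab y x h2, (h1 i).2]⟩

end

/-! ### Averages over cylinders -/

variable [∀ i, Fintype (X i)]

theorem cell_cyl (x : ∀ i, X i) : cell S.cyl x = Fintype.piFinset (S.cyl x) := by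
  ext y
  rw [mem_cell, Fintype.mem_piFinset]
  exact ⟨S.mem_of_cyl_eq, S.cyl_eq x y⟩

theorem cellAvg_pair (x : ∀ i, X i) {i j : Fin t} (hij : i ≠ j) {G : (∀ i, X i) → ℝ}
    {F : X i → X j → ℝ} (hG : ∀ y, S.cyl y = S.cyl x → G y = F (y i) (y j)) :
    cellAvg S.cyl G x = (∑ u ∈ S.cyl x i, ∑ v ∈ S.cyl x j, F u v) /
      ((S.cyl x i).card * (S.cyl x j).card) := by
  have hpos := card_cell_pos S.cyl x
  rw [cellAvg, Finset.sum_congr rfl fun y hy => hG y (mem_cell.1 hy), S.cell_cyl] at *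
  have h := sum_piFinset_pair (S.cyl x) hij F
  have h1 := S.card_cyl_pos x i
  have h2 := S.card_cyl_pos x j
  rw [div_eq_div_iff hpos.ne' (by positivity), mul_comm, h, mul_comm]

open scoped Classical in
theorem cellAvg_triple (x : ∀ i, X i) {i j k : Fin t} (hij : i ≠ j) (hik : i ≠ k) (hjk : j ≠ k)
    {L : Type*} (κ : (∀ i, X i) → L) (Δ : Finset (X i × X j × X k))
    (hΔ : Δ ⊆ S.cyl x i ×ˢ S.cyl x j ×ˢ S.cyl x k)
    (hκ : ∀ y, κ y = κ x ↔ S.cyl y = S.cyl x ∧ (y i, y j, y k) ∈ Δ)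
    {G : (∀ i, X i) → ℝ} {F : X i → X j → X k → ℝ}
    (hG : ∀ y, κ y = κ x → G y = F (y i) (y j) (y k)) :
    cellAvg κ G x = (∑ v ∈ Δ, F v.1 v.2.1 v.2.2) / Δ.card := by
  have hcell : cell κ x = (Fintype.piFinset (S.cyl x)).filter fun y => (y i, y j, y k) ∈ Δ := by
    ext y
    rw [mem_cell, hκ, Finset.mem_filter, ← S.cell_cyl, mem_cell]
  have h1 := S.card_cyl_pos x i
  have h2 := S.card_cyl_pos x j
  have h3 := S.card_cyl_pos x k
  have key : ∀ F' : X i → X j → X k → ℝ,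
      ((S.cyl x i).card * (S.cyl x j).card * (S.cyl x k).card : ℝ) *
        ∑ y ∈ cell κ x, F' (y i) (y j) (y k)
      = (Fintype.piFinset (S.cyl x)).card * ∑ v ∈ Δ, F' v.1 v.2.1 v.2.2 := by
    intro F'
    have h := sum_piFinset_triple (S.cyl x) hij hik hjk
      fun u v w => if (u, v, w) ∈ Δ then F' u v w else 0
    rw [← Finset.sum_filter, ← hcell] at h
    rw [h]
    congr 1
    have : Δ = (S.cyl x i ×ˢ S.cyl x j ×ˢ S.cyl x k).filter fun v => v ∈ Δ := by
      rw [Finset.filter_mem_eq_inter, Finset.inter_eq_right.2 hΔ]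
    conv_rhs => rw [this, Finset.sum_filter]
    simp only [Finset.sum_product]
  have hone := key fun _ _ _ => 1
  simp only [Finset.sum_const, nsmul_eq_mul, mul_one] at hone
  have hF := key F
  have hpos := card_cell_pos κ x
  have hpi : (0 : ℝ) < (Fintype.piFinset (S.cyl x)).card := by
    rw [← S.cell_cyl]
    exact card_cell_pos S.cyl x
  have hΔpos : (0 : ℝ) < Δ.card := by
    by_contra hcon
    have : (0 : ℝ) < (S.cyl x i).card * (S.cyl x j).card * (S.cyl x k).card * (cell κ x).card := by
      positivity
    rw [hone] at this
    exact hcon (pos_of_mul_pos_right this hpi.le)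
  rw [cellAvg, Finset.sum_congr rfl fun y hy => hG y (mem_cell.1 hy),
    div_eq_div_iff hpos.ne' hΔpos.ne']
  have hP : (0 : ℝ) < (S.cyl x i).card * (S.cyl x j).card * (S.cyl x k).card *
      (Fintype.piFinset (S.cyl x)).card := by positivity
  refine mul_left_cancel₀ hP.ne' ?_
  linear_combination (Fintype.piFinset (S.cyl x)).card * Δ.card * hF
    - (Fintype.piFinset (S.cyl x)).card * (∑ v ∈ Δ, F v.1 v.2.1 v.2.2) * hone

/-! ### Vertex regularisation -/

variable [∀ i, DecidableEq (X i)]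

/-- The number of cylinders. -/
def numCyl : ℕ := (Finset.univ.image S.cyl).card

theorem numCyl_splitVertices_le {Λ : Type*} [DecidableEq Λ] [Fintype Λ]
    (lab : (∀ i, X i) → ∀ i, X i → Λ) (hlab : ∀ x y, S.cyl y = S.cyl x → lab y = lab x) :
    (S.splitVertices lab hlab).numCyl ≤ S.numCyl * Fintype.card Λ ^ t := by
  have hsub : Finset.univ.image (S.splitVertices lab hlab).cyl
      ⊆ ((Finset.univ.image fun x => (S.cyl x, fun i => lab x i (x i)))).image
        fun p => if h : ∃ x, (S.cyl x, fun i => lab x i (x i)) = p then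
          (S.splitVertices lab hlab).cyl h.choose else fun _ => ∅ := by
    intro Y hY
    obtain ⟨x, -, rfl⟩ := Finset.mem_image.1 hY
    refine Finset.mem_image.2 ⟨_, Finset.mem_image_of_mem _ (Finset.mem_univ x), ?_⟩
    have hex : ∃ y, (S.cyl y, fun i => lab y i (y i)) = (S.cyl x, fun i => lab x i (x i)) := ⟨x, rfl⟩
    rw [dif_pos hex]
    have hspec := hex.choose_spec
    generalize hex.choose = y at hspec
    obtain ⟨h1, h2⟩ := Prod.ext_iff.1 hspec
    funext i
    have h3 := congrFun h2 i
    simp only [splitVertices] at h1 h3 ⊢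
    rw [h1, h3, hlab x y h1]
  refine (Finset.card_le_card hsub).trans (Finset.card_image_le.trans ?_)
  have hsub2 : Finset.univ.image (fun x => (S.cyl x, fun i => lab x i (x i)))
      ⊆ Finset.univ.image S.cyl ×ˢ Finset.univ := by
    intro p hp
    obtain ⟨x, -, rfl⟩ := Finset.mem_image.1 hp
    exact Finset.mem_product.2 ⟨Finset.mem_image_of_mem _ (Finset.mem_univ x), Finset.mem_univ _⟩
  refine (Finset.card_le_card hsub2).trans (le_of_eq ?_)
  rw [Finset.card_product, Finset.card_univ, Fintype.card_fun, Fintype.card_fin, numCyl]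

end ColoredCylinders

/-- The pairs of indices `i < j`. -/
def indexPairs (t : ℕ) : Finset (Fin t × Fin t) := {p | p.1 < p.2}

theorem card_indexPairs_le (t : ℕ) : (indexPairs t).card ≤ t ^ 2 := by
  refine (Finset.card_filter_le _ _).trans (le_of_eq ?_)
  simp [sq]

theorem mem_indexPairs {p : Fin t × Fin t} : p ∈ indexPairs t ↔ p.1 < p.2 := by
  simp [indexPairs]

namespace ColoredCylinders

variable {M : ℕ} (S : ColoredCylinders X M) [∀ i, Fintype (X i)]

open scoped Classical in
/-- The indicator function of the tuples whose pair in the positions `i`, `j` has colour `a`. -/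
noncomputable def colInd (i j : Fin t) (a : Fin M) (y : ∀ i, X i) : ℝ :=
  if S.col y i j (y i) (y j) = a then 1 else 0

/-- The potential for the vertex regularisation: the sum over all pairs of sides and all colours
of the residual of the colour class with respect to the cylinders. -/
noncomputable def pairResidual : ℝ :=
  ∑ p ∈ indexPairs t, ∑ a, residual S.cyl (S.colInd p.1 p.2 a)

theorem pairResidual_nonneg : 0 ≤ S.pairResidual :=
  Finset.sum_nonneg fun _ _ => Finset.sum_nonneg fun _ _ => residual_nonneg _ _

theorem pairResidual_le : S.pairResidual ≤ t ^ 2 * Fintype.card (∀ i, X i) := by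
  have h : ∀ p ∈ indexPairs t, ∑ a, residual S.cyl (S.colInd p.1 p.2 a)
      ≤ Fintype.card (∀ i, X i) := by
    intro p _
    refine (Finset.sum_le_sum fun a _ => residual_le_sum_sq _ _).trans (le_of_eq ?_)
    rw [Finset.sum_comm, ← Finset.card_univ, ← nsmul_one, ← Finset.sum_const]
    refine Finset.sum_congr rfl fun x _ => ?_
    simp [colInd]
  refine (Finset.sum_le_sum h).trans ?_
  rw [Finset.sum_const, nsmul_eq_mul]
  refine mul_le_mul_of_nonneg_right ?_ (Nat.cast_nonneg _)
  exact_mod_cast card_indexPairs_le t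

theorem cellAvg_colInd (x : ∀ i, X i) {i j : Fin t} (hij : i ≠ j) (a : Fin M) :
    cellAvg S.cyl (S.colInd i j a) x = S.dens x i j a := by
  classical
  rw [S.cellAvg_pair x hij (F := fun u v => if S.col x i j u v = a then 1 else 0) fun y hy => by
    rw [colInd, S.col_congr hy], dens, bipDensity, edges]
  congr 1
  rw [← Finset.sum_product', Finset.sum_boole]

variable [∀ i, DecidableEq (X i)]

open scoped Classical in
/-- The tuples in whose cylinder some colour class is not `c`-quasirandom. -/
noncomputable def badPairs (c : ℝ) : Finset (∀ i, X i) :=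
  {x | ∃ (i j : Fin t) (a : Fin M), i < j ∧
    ¬ IsQuasirandomPair (S.cyl x i) (S.cyl x j) (S.edges x i j a) c}

/-- One step of the vertex regularisation: split the sides of each cylinder according to witnesses
of irregularity, for all pairs of sides and all colours at once. -/
theorem exists_splitVertices (c : ℝ) (hc : 0 ≤ c) :
    ∃ S' : ColoredCylinders X M, S'.col = S.col ∧
      (∀ x y, S'.cyl x = S'.cyl y → S.cyl x = S.cyl y) ∧
      S'.numCyl ≤ S.numCyl * 4 ^ (t * M * t) ∧
      S'.pairResidual ≤ S.pairResidual - c ^ 2 * (S.badPairs c).card := by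
  classical
  choose p q φ hpq using fun (i j : Fin t) (A : Finset (X i)) (B : Finset (X j))
    (E : Finset (X i × X j)) => exists_bipartite_labels A B E c
  let lab : (∀ i, X i) → ∀ i, X i → (Fin t → Fin M → Bool × Bool) := fun x i u j a =>
    (p i j (S.cyl x i) (S.cyl x j) (S.edges x i j a) u,
      q j i (S.cyl x j) (S.cyl x i) (S.edges x j i a) u)
  have hlab : ∀ x y, S.cyl y = S.cyl x → lab y = lab x := by
    intro x y h
    funext i u j a
    simp only [lab, h, S.edges_congr h]
  refine ⟨S.splitVertices lab hlab, rfl, fun x y h => (S.splitVertices_cyl_eq lab hlab h).1,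
    (S.numCyl_splitVertices_le lab hlab).trans (le_of_eq ?_), ?_⟩
  · simp only [Fintype.card_fun, Fintype.card_prod, Fintype.card_bool, Fintype.card_fin]
    rw [← pow_mul, ← pow_mul]
    congr 2
    ring
  have hgain : ∀ (i j : Fin t) (hij : i < j) (a : Fin M),
      residual (S.splitVertices lab hlab).cyl (S.colInd i j a)
      ≤ residual S.cyl (S.colInd i j a) - ∑ x, if ¬ IsQuasirandomPair (S.cyl x i) (S.cyl x j)
        (S.edges x i j a) c then c ^ 2 else 0 := by
    intro i j hij a
    let Φ : (∀ i, X i) → ℝ := fun y =>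
      φ i j (S.cyl y i) (S.cyl y j) (S.edges y i j a) (lab y i (y i) j a).1 (lab y j (y j) i a).2
    refine (residual_le_sub (S.colInd i j a) Φ
      (fun x y h => (S.splitVertices_cyl_eq lab hlab h).1) fun x y h => ?_).trans ?_
    · obtain ⟨h1, h2⟩ := S.splitVertices_cyl_eq lab hlab h
      simp only [Φ, h1, S.edges_congr h1, h2]
    · refine sub_le_sub_left (Finset.sum_le_sum fun x _ => ?_) _
      have hspec := hpq i j (S.cyl x i) (S.cyl x j) (S.edges x i j a) (S.edges_subset x i j a) hc
      have hpos : (0 : ℝ) < (S.cyl x i).card * (S.cyl x j).card :=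
        mul_pos (S.card_cyl_pos x i) (S.card_cyl_pos x j)
      rw [S.cellAvg_pair x hij.ne (F := fun u v =>
        2 * bipBalanced (S.cyl x i) (S.cyl x j) (S.edges x i j a) u v *
          φ i j (S.cyl x i) (S.cyl x j) (S.edges x i j a)
            (p i j (S.cyl x i) (S.cyl x j) (S.edges x i j a) u)
            (q i j (S.cyl x i) (S.cyl x j) (S.edges x i j a) v)
          - φ i j (S.cyl x i) (S.cyl x j) (S.edges x i j a)
            (p i j (S.cyl x i) (S.cyl x j) (S.edges x i j a) u)
            (q i j (S.cyl x i) (S.cyl x j) (S.edges x i j a) v) ^ 2)]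
      · split_ifs with hbad
        · exact div_nonneg hspec.1 hpos.le
        · rw [le_div_iff₀ hpos, ← mul_assoc]
          exact hspec.2 hbad
      · intro y hy
        have hmem : (y i, y j) ∈ S.cyl x i ×ˢ S.cyl x j :=
          Finset.mem_product.2 ⟨S.mem_of_cyl_eq hy i, S.mem_of_cyl_eq hy j⟩
        have hbal : S.colInd i j a y - cellAvg S.cyl (S.colInd i j a) y
            = bipBalanced (S.cyl x i) (S.cyl x j) (S.edges x i j a) (y i) (y j) := by
          rw [cellAvg_congr _ hy, S.cellAvg_colInd x hij.ne, colInd, bipBalanced, S.col_congr hy,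
            dens]
          simp [edges, hmem]
        simp only [hbal, Φ, lab, hy, S.edges_congr hy]
  have htotal : c ^ 2 * ((S.badPairs c).card : ℝ) ≤ ∑ r ∈ indexPairs t, ∑ a, ∑ x,
      if ¬ IsQuasirandomPair (S.cyl x r.1) (S.cyl x r.2) (S.edges x r.1 r.2 a) c
        then c ^ 2 else 0 := by
    have hnn : ∀ (r : Fin t × Fin t) (a : Fin M) (x : ∀ i, X i),
        0 ≤ if ¬ IsQuasirandomPair (S.cyl x r.1) (S.cyl x r.2) (S.edges x r.1 r.2 a) c
          then c ^ 2 else 0 := fun r a x => by split_ifs <;> positivity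
    rw [Finset.sum_congr rfl fun r _ => Finset.sum_comm, Finset.sum_comm, mul_comm, ← nsmul_eq_mul,
      ← Finset.sum_const]
    refine (Finset.sum_le_sum fun x hx => ?_).trans (Finset.sum_le_sum_of_subset_of_nonneg
      (Finset.subset_univ _) fun x _ _ => Finset.sum_nonneg fun r _ =>
        Finset.sum_nonneg fun a _ => hnn r a x)
    obtain ⟨i, j, a, hij, hbad⟩ := (Finset.mem_filter.1 hx).2
    refine le_trans ?_ (Finset.single_le_sum (fun r _ => Finset.sum_nonneg fun a _ => hnn r a x)
      (mem_indexPairs.2 hij : (i, j) ∈ indexPairs t))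
    refine le_trans ?_ (Finset.single_le_sum (fun a _ => hnn (i, j) a x) (Finset.mem_univ a))
    rw [if_pos hbad]
  refine (Finset.sum_le_sum fun r hr => Finset.sum_le_sum fun a _ =>
    hgain r.1 r.2 (mem_indexPairs.1 hr) a).trans ?_
  simp only [Finset.sum_sub_distrib]
  rw [pairResidual]
  linarith

/-- Vertex regularisation: after at most `n` splittings, where `n` bounds the potential in units of
the gain of a step, all colour classes are quasirandom on all but a fraction `ε` of the cylinders. -/
theorem exists_vertex_regular {c ε : ℝ} (hc : 0 < c) (hε : 0 ≤ ε) (n : ℕ)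
    (hn : S.pairResidual ≤ n * (c ^ 2 * (ε * Fintype.card (∀ i, X i)))) :
    ∃ S' : ColoredCylinders X M, S'.col = S.col ∧
      (∀ x y, S'.cyl x = S'.cyl y → S.cyl x = S.cyl y) ∧
      S'.numCyl ≤ S.numCyl * (4 ^ (t * M * t)) ^ n ∧
      ((S'.badPairs c).card : ℝ) ≤ ε * Fintype.card (∀ i, X i) := by
  induction n generalizing S with
  | zero =>
    refine ⟨S, rfl, fun _ _ h => h, by simp, ?_⟩
    by_contra! hcon
    obtain ⟨S', -, -, -, h⟩ := S.exists_splitVertices c hc.le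
    have h1 := S'.pairResidual_nonneg
    have h2 : 0 < ((S.badPairs c).card : ℝ) :=
      lt_of_le_of_lt (mul_nonneg hε (Nat.cast_nonneg _)) hcon
    have h3 : 0 < c ^ 2 * ((S.badPairs c).card : ℝ) := by positivity
    simp only [Nat.cast_zero, zero_mul] at hn
    linarith
  | succ n ih =>
    by_cases hbad : ((S.badPairs c).card : ℝ) ≤ ε * Fintype.card (∀ i, X i)
    · exact ⟨S, rfl, fun _ _ h => h, Nat.le_mul_of_pos_right _ (by positivity), hbad⟩
    · obtain ⟨S₁, hcol, href, hnum, hres⟩ := S.exists_splitVertices c hc.le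
      obtain ⟨S', hcol', href', hnum', hbad'⟩ := ih S₁ (by
        have h1 := mul_le_mul_of_nonneg_left (not_le.1 hbad).le (sq_nonneg c)
        push_cast at hn
        linarith)
      refine ⟨S', hcol'.trans hcol, fun x y h => href x y (href' x y h), ?_, hbad'⟩
      calc S'.numCyl ≤ S₁.numCyl * (4 ^ (t * M * t)) ^ n := hnum'
        _ ≤ S.numCyl * 4 ^ (t * M * t) * (4 ^ (t * M * t)) ^ n := Nat.mul_le_mul_right _ hnum
        _ = _ := by ring

end ColoredCylinders

/-! ### Refining the edge partitions -/

/-- The triples of indices `i < j < k`. -/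
def indexTriples (t : ℕ) : Finset (Fin t × Fin t × Fin t) := {p | p.1 < p.2.1 ∧ p.2.1 < p.2.2}

theorem card_indexTriples_le (t : ℕ) : (indexTriples t).card ≤ t ^ 3 := by
  refine (Finset.card_filter_le _ _).trans (le_of_eq ?_)
  simp only [Finset.card_univ, Fintype.card_prod, Fintype.card_fin]
  ring

theorem mem_indexTriples {p : Fin t × Fin t × Fin t} :
    p ∈ indexTriples t ↔ p.1 < p.2.1 ∧ p.2.1 < p.2.2 := by
  simp [indexTriples]

/-- The labels of a pair of vertices for all triads, which are given by a third side and the colours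
of their three pairs. -/
abbrev TriadLabel (t M s : ℕ) : Type :=
  Fin t × Fin M × Fin M × Fin M → PairLabel s

namespace ColoredCylinders

variable {M : ℕ} (S : ColoredCylinders X M)

/-- The cylinder of `x` and the colours of the three pairs in the positions `i`, `j`, `k`. -/
def tripleCell (i j k : Fin t) (x : ∀ i, X i) :
    (∀ i, Finset (X i)) × Fin M × Fin M × Fin M :=
  (S.cyl x, S.col x i j (x i) (x j), S.col x i k (x i) (x k), S.col x j k (x j) (x k))

/-- Replace the colouring by another one. -/
def recolor {M' : ℕ} (col' : (∀ i, X i) → ∀ i j, X i → X j → Fin M')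
    (h : ∀ x y, S.cyl y = S.cyl x → col' y = col' x) : ColoredCylinders X M' where
  cyl := S.cyl
  col := col'
  mem_cyl := S.mem_cyl
  cyl_eq := S.cyl_eq
  col_eq x y hxy := h x y (S.cyl_eq x y hxy)

variable [∀ i, DecidableEq (X i)]

/-- The triangles formed by the pairs of the colours `a`, `b`, `c` in the cylinder of `x`. -/
def colorTriad (x : ∀ i, X i) (i j k : Fin t) (a b c : Fin M) : Finset (X i × X j × X k) :=
  triad (S.cyl x i) (S.cyl x j) (S.cyl x k) (S.edges x i j a) (S.edges x i k b) (S.edges x j k c)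

theorem tripleCell_eq_iff (i j k : Fin t) (x y : ∀ i, X i) :
    S.tripleCell i j k y = S.tripleCell i j k x ↔ S.cyl y = S.cyl x ∧
      (y i, y j, y k) ∈ S.colorTriad x i j k (S.col x i j (x i) (x j)) (S.col x i k (x i) (x k))
        (S.col x j k (x j) (x k)) := by
  simp only [tripleCell, Prod.mk.injEq]
  refine and_congr_right fun h => ?_
  rw [S.col_congr h]
  have := S.mem_of_cyl_eq h
  simp [colorTriad, triad, edges, this]

variable (H : PartiteThreeGraph X)

/-- The indicator function of the tuples whose vertices in the positions `i`, `j`, `k` form an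
edge. -/
noncomputable def edgeInd (i j k : Fin t) (y : ∀ i, X i) : ℝ :=
  if H.IsEdge (y i) (y j) (y k) then 1 else 0

variable [∀ i, Fintype (X i)]

/-- The potential for the chain: the sum over all triples of sides of the residual of the `3`-graph
with respect to the cylinders and the edge partitions. -/
noncomputable def tripleResidual : ℝ :=
  ∑ p ∈ indexTriples t, residual (S.tripleCell p.1 p.2.1 p.2.2) (edgeInd H p.1 p.2.1 p.2.2)

theorem tripleResidual_nonneg : 0 ≤ S.tripleResidual H :=
  Finset.sum_nonneg fun _ _ => residual_nonneg _ _

theorem tripleResidual_le : S.tripleResidual H ≤ t ^ 3 * Fintype.card (∀ i, X i) := by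
  have h : ∀ p ∈ indexTriples t, residual (S.tripleCell p.1 p.2.1 p.2.2)
      (edgeInd H p.1 p.2.1 p.2.2) ≤ Fintype.card (∀ i, X i) := by
    intro p _
    refine (residual_le_sum_sq _ _).trans ?_
    rw [← Finset.card_univ, ← nsmul_one, ← Finset.sum_const]
    refine Finset.sum_le_sum fun x _ => ?_
    rw [edgeInd]
    split_ifs <;> norm_num
  refine (Finset.sum_le_sum h).trans ?_
  rw [Finset.sum_const, nsmul_eq_mul]
  refine mul_le_mul_of_nonneg_right ?_ (Nat.cast_nonneg _)
  exact_mod_cast card_indexTriples_le t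

theorem tripleResidual_mono {S S' : ColoredCylinders X M} (hcol : S'.col = S.col)
    (hcyl : ∀ x y, S'.cyl x = S'.cyl y → S.cyl x = S.cyl y) :
    S'.tripleResidual H ≤ S.tripleResidual H := by
  refine Finset.sum_le_sum fun p _ => residual_mono _ fun x y h => ?_
  simp only [tripleCell, Prod.mk.injEq, hcol] at h ⊢
  exact ⟨hcyl x y h.1, h.2⟩

theorem cellAvg_edgeInd (x : ∀ i, X i) {i j k : Fin t} (hij : i < j) (hjk : j < k) :
    cellAvg (S.tripleCell i j k) (edgeInd H i j k) x
      = triadDensity (S.colorTriad x i j k (S.col x i j (x i) (x j)) (S.col x i k (x i) (x k))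
        (S.col x j k (x j) (x k))) fun u v w => H.IsEdge u v w := by
  rw [S.cellAvg_triple x hij.ne (hij.trans hjk).ne hjk.ne (S.tripleCell i j k) _
    (Finset.filter_subset _ _) (fun y => S.tripleCell_eq_iff i j k x y) (G := edgeInd H i j k)
    (F := fun u v w => if H.IsEdge u v w then 1 else 0) fun y _ => rfl, triadDensity,
    Finset.sum_boole]
  rfl

open scoped Classical in
/-- The tuples for which the triad in some three positions is irregular. -/
noncomputable def badTriads (η : ℝ) (s : ℕ) : Finset (∀ i, X i) :=
  {x | ∃ i j k : Fin t, i < j ∧ j < k ∧ IsIrregularTriad (S.cyl x i) (S.cyl x j) (S.cyl x k)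
    (S.edges x i j (S.col x i j (x i) (x j))) (S.edges x i k (S.col x i k (x i) (x k)))
    (S.edges x j k (S.col x j k (x j) (x k))) (fun u v w => H.IsEdge u v w) η s}

set_option synthInstance.maxSize 1024 in
/-- Refining the colouring in each cylinder according to witnesses of irregularity, for all triads
at once, decreases the potential in proportion to the number of irregular tuples. -/
theorem exists_recolor {η : ℝ} (hη : 0 < η) (s : ℕ) {M' : ℕ}
    (hM' : M * 16 ^ (3 * s * t * M ^ 3) ≤ M') :
    ∃ S' : ColoredCylinders X M', S'.cyl = S.cyl ∧
      S'.tripleResidual H ≤ S.tripleResidual H - η ^ 2 / 3 * (S.badTriads H η s).card := by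
  classical
  choose p q r φ hspec using fun (i j k : Fin t) (U : Finset (X i)) (V : Finset (X j))
    (W : Finset (X k)) (A : Finset (X i × X j)) (B : Finset (X i × X k))
    (C : Finset (X j × X k)) =>
    exists_triad_labels U V W A B C (fun u v w => H.IsEdge u v w) η s
  let P : (∀ i, X i) → ∀ i j _ : Fin t, Fin M × Fin M × Fin M → X i → X j → PairLabel s :=
    fun x i j k a => p i j k (S.cyl x i) (S.cyl x j) (S.cyl x k) (S.edges x i j a.1)
      (S.edges x i k a.2.1) (S.edges x j k a.2.2)
  let Q : (∀ i, X i) → ∀ i _ k : Fin t, Fin M × Fin M × Fin M → X i → X k → PairLabel s :=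
    fun x i j k a => q i j k (S.cyl x i) (S.cyl x j) (S.cyl x k) (S.edges x i j a.1)
      (S.edges x i k a.2.1) (S.edges x j k a.2.2)
  let R : (∀ i, X i) → ∀ _ j k : Fin t, Fin M × Fin M × Fin M → X j → X k → PairLabel s :=
    fun x i j k a => r i j k (S.cyl x i) (S.cyl x j) (S.cyl x k) (S.edges x i j a.1)
      (S.edges x i k a.2.1) (S.edges x j k a.2.2)
  let F : (∀ i, X i) → Fin t → Fin t → Fin t → Fin M × Fin M × Fin M →
      PairLabel s → PairLabel s → PairLabel s → ℝ :=
    fun x i j k a => φ i j k (S.cyl x i) (S.cyl x j) (S.cyl x k) (S.edges x i j a.1)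
      (S.edges x i k a.2.1) (S.edges x j k a.2.2)
  have hPQR : ∀ x y, S.cyl y = S.cyl x → P y = P x ∧ Q y = Q x ∧ R y = R x ∧ F y = F x := by
    intro x y h
    simp only [P, Q, R, F, h, S.edges_congr h, and_self]
  -- A pair of sides can be the first and second, the first and third, or the second and third of
  -- the sides of a triad; the new colour records the labels for all three roles.
  obtain ⟨e⟩ : Nonempty (Fin M × TriadLabel t M s × TriadLabel t M s × TriadLabel t M s ↪
      Fin M') := by
    refine Function.Embedding.nonempty_of_card_le (le_trans (le_of_eq ?_)
      (hM'.trans_eq (Fintype.card_fin M').symm))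
    simp only [Fintype.card_prod, Fintype.card_fun, Fintype.card_fin, Fintype.card_bool]
    rw [show 2 * 2 * (2 * 2) = 16 from rfl, ← pow_mul, ← pow_add, ← pow_add]
    congr 2
    ring
  let col' : (∀ i, X i) → ∀ i j, X i → X j → Fin M' := fun x i j u v =>
    e (S.col x i j u v, fun τ => P x i j τ.1 τ.2 u v, fun τ => Q x i τ.1 j τ.2 u v,
      fun τ => R x τ.1 i j τ.2 u v)
  have hcol' : ∀ x y, S.cyl y = S.cyl x → col' y = col' x := by
    intro x y h
    obtain ⟨hP, hQ, hR, -⟩ := hPQR x y h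
    simp only [col', hP, hQ, hR, S.col_congr h]
  refine ⟨S.recolor col' hcol', rfl, ?_⟩
  let cl : (∀ i, X i) → ∀ i j k : Fin t, Fin M × Fin M × Fin M := fun x i j k =>
    (S.col x i j (x i) (x j), S.col x i k (x i) (x k), S.col x j k (x j) (x k))
  let Irr : (∀ i, X i) → Fin t × Fin t × Fin t → Prop := fun x m =>
    IsIrregularTriad (S.cyl x m.1) (S.cyl x m.2.1) (S.cyl x m.2.2)
      (S.edges x m.1 m.2.1 (S.col x m.1 m.2.1 (x m.1) (x m.2.1)))
      (S.edges x m.1 m.2.2 (S.col x m.1 m.2.2 (x m.1) (x m.2.2)))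
      (S.edges x m.2.1 m.2.2 (S.col x m.2.1 m.2.2 (x m.2.1) (x m.2.2)))
      (fun u v w => H.IsEdge u v w) η s
  have hgain : ∀ (i j k : Fin t), i < j → j < k →
      residual ((S.recolor col' hcol').tripleCell i j k) (edgeInd H i j k)
      ≤ residual (S.tripleCell i j k) (edgeInd H i j k)
        - ∑ x, if Irr x (i, j, k) then η ^ 2 / 3 else 0 := by
    intro i j k hij hjk
    let Φ : (∀ i, X i) → ℝ := fun y => F y i j k (cl y i j k) (P y i j k (cl y i j k) (y i) (y j))
      (Q y i j k (cl y i j k) (y i) (y k)) (R y i j k (cl y i j k) (y j) (y k))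
    have hmeas : ∀ x y, (S.recolor col' hcol').tripleCell i j k x
        = (S.recolor col' hcol').tripleCell i j k y →
        S.tripleCell i j k x = S.tripleCell i j k y ∧ Φ x = Φ y := by
      intro x y h
      simp only [tripleCell, recolor, Prod.mk.injEq] at h
      obtain ⟨h0, h1, h2, h3⟩ := h
      obtain ⟨hP, hQ, hR, hF⟩ := hPQR y x h0
      simp only [col', EmbeddingLike.apply_eq_iff_eq, Prod.mk.injEq] at h1 h2 h3
      obtain ⟨h1, h1', -, -⟩ := h1
      obtain ⟨h2, -, h2', -⟩ := h2
      obtain ⟨h3, -, -, h3'⟩ := h3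
      have hcl : cl x i j k = cl y i j k := by
        simp only [cl, h1, h2, h3]
      refine ⟨by simp only [tripleCell, h0, h1, h2, h3], ?_⟩
      have e1 := congrFun h1' (k, cl y i j k)
      have e2 := congrFun h2' (j, cl y i j k)
      have e3 := congrFun h3' (i, cl y i j k)
      dsimp only at e1 e2 e3
      simp only [Φ, hcl, hF]
      rw [e1, e2, e3]
    refine (residual_le_sub (edgeInd H i j k) Φ (fun x y h => (hmeas x y h).1)
      fun x y h => (hmeas x y h).2).trans ?_
    refine sub_le_sub_left (Finset.sum_le_sum fun x _ => ?_) _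
    have hsp := hspec i j k (S.cyl x i) (S.cyl x j) (S.cyl x k)
      (S.edges x i j (S.col x i j (x i) (x j))) (S.edges x i k (S.col x i k (x i) (x k)))
      (S.edges x j k (S.col x j k (x j) (x k))) (S.edges_subset _ _ _ _) (S.edges_subset _ _ _ _)
      (S.edges_subset _ _ _ _) hη
    set Δ := S.colorTriad x i j k (S.col x i j (x i) (x j)) (S.col x i k (x i) (x k))
        (S.col x j k (x j) (x k)) with hΔ
    have hΔpos : (0 : ℝ) < Δ.card := by
      exact_mod_cast Finset.card_pos.2 ⟨_, ((S.tripleCell_eq_iff i j k x x).1 rfl).2⟩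
    rw [S.cellAvg_triple x hij.ne (hij.trans hjk).ne hjk.ne (S.tripleCell i j k) Δ
      (Finset.filter_subset _ _) (fun y => S.tripleCell_eq_iff i j k x y) (F := fun u v w =>
        2 * triadBalanced Δ (fun u v w => H.IsEdge u v w) u v w *
          F x i j k (cl x i j k) (P x i j k (cl x i j k) u v)
            (Q x i j k (cl x i j k) u w) (R x i j k (cl x i j k) v w)
        - F x i j k (cl x i j k) (P x i j k (cl x i j k) u v)
            (Q x i j k (cl x i j k) u w) (R x i j k (cl x i j k) v w) ^ 2)]
    · split_ifs with hbad
      · rw [le_div_iff₀ hΔpos]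
        exact hsp.2 hbad
      · exact div_nonneg hsp.1 hΔpos.le
    · intro y hy
      have hmem := ((S.tripleCell_eq_iff i j k x y).1 hy).2
      rw [← hΔ] at hmem
      have hbal : edgeInd H i j k y - cellAvg (S.tripleCell i j k) (edgeInd H i j k) y
          = triadBalanced Δ (fun u v w => H.IsEdge u v w) (y i) (y j) (y k) := by
        rw [cellAvg_congr _ hy, S.cellAvg_edgeInd H x hij hjk, edgeInd, triadBalanced, if_pos hmem]
      simp only [tripleCell, Prod.mk.injEq] at hy
      obtain ⟨h0, h1, h2, h3⟩ := hy
      obtain ⟨hP, hQ, hR, hF⟩ := hPQR x y h0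
      have hcl : cl y i j k = cl x i j k := by
        simp only [cl, h1, h2, h3]
      simp only [hbal, Φ, hP, hQ, hR, hF, hcl]
  have htotal : η ^ 2 / 3 * ((S.badTriads H η s).card : ℝ) ≤ ∑ m ∈ indexTriples t, ∑ x,
      if Irr x m then η ^ 2 / 3 else 0 := by
    have hnn : ∀ (m : Fin t × Fin t × Fin t) (x : ∀ i, X i),
        0 ≤ if Irr x m then η ^ 2 / 3 else 0 := fun m x => by split_ifs <;> positivity
    rw [Finset.sum_comm, mul_comm, ← nsmul_eq_mul, ← Finset.sum_const]
    refine (Finset.sum_le_sum fun x hx => ?_).trans (Finset.sum_le_sum_of_subset_of_nonneg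
      (Finset.subset_univ _) fun x _ _ => Finset.sum_nonneg fun m _ => hnn m x)
    obtain ⟨i, j, k, hij, hjk, hbad⟩ := (Finset.mem_filter.1 hx).2
    refine le_trans ?_ (Finset.single_le_sum (fun m _ => hnn m x)
      (mem_indexTriples.2 ⟨hij, hjk⟩ : (i, j, k) ∈ indexTriples t))
    rw [if_pos hbad]
  refine (Finset.sum_le_sum fun m hm =>
    hgain m.1 m.2.1 m.2.2 (mem_indexTriples.1 hm).1 (mem_indexTriples.1 hm).2).trans ?_
  rw [Finset.sum_sub_distrib, tripleResidual]
  linarith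

end ColoredCylinders

/-! ### Tuples of low density -/

namespace ColoredCylinders

variable {M : ℕ} (S : ColoredCylinders X M)

/-- The graph of the colour classes of the pairs of `x` in the cylinder of `x`. -/
def graph (x : ∀ i, X i) : PartiteGraph (S.cyl x) where
  edges i j _ := S.edges x i j (S.col x i j (x i) (x j))
  subset i j _ := S.edges_subset x i j _

theorem productDensity_le_one (x : ∀ i, X i) : (S.graph x).productDensity ≤ 1 :=
  Finset.prod_le_one (fun _ _ => bipDensity_nonneg _ _ _)
    fun p _ => bipDensity_le_one ((S.graph x).subset p.1.1 p.1.2 p.2)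

variable [∀ i, Fintype (X i)]

open scoped Classical in
/-- The tuples for which some colour class of a pair has density less than `ε`. -/
noncomputable def lowDensity (ε : ℝ) : Finset (∀ i, X i) :=
  {x | ∃ i j : Fin t, i < j ∧ S.dens x i j (S.col x i j (x i) (x j)) < ε}

theorem card_lowDensity_le {ε : ℝ} (hε : 0 ≤ ε) :
    ((S.lowDensity ε).card : ℝ) ≤ t ^ 2 * M * ε * Fintype.card (∀ i, X i) := by
  classical
  have h1 : ∀ p ∈ indexPairs t, ∑ x, (if S.dens x p.1 p.2 (S.col x p.1 p.2 (x p.1) (x p.2)) < ε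
      then (1 : ℝ) else 0) ≤ M * ε * Fintype.card (∀ i, X i) := by
    intro p hp
    have h2 : ∀ x, (if S.dens x p.1 p.2 (S.col x p.1 p.2 (x p.1) (x p.2)) < ε then (1 : ℝ) else 0)
        = ∑ a, (if S.dens x p.1 p.2 a < ε then 1 else 0) * S.colInd p.1 p.2 a x := by
      intro x
      simp [colInd]
    rw [Finset.sum_congr rfl fun x _ => h2 x, Finset.sum_comm]
    have h3 : ∀ a : Fin M, ∑ x, (if S.dens x p.1 p.2 a < ε then 1 else 0) * S.colInd p.1 p.2 a x
        ≤ ε * Fintype.card (∀ i, X i) := by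
      intro a
      rw [← sum_mul_cellAvg S.cyl _ (fun x => if S.dens x p.1 p.2 a < ε then (1 : ℝ) else 0)
        fun x y h => if_congr (by rw [dens, dens, h, S.edges_congr h]) rfl rfl, mul_comm, ← Finset.card_univ,
        ← nsmul_eq_mul, ← Finset.sum_const]
      refine Finset.sum_le_sum fun x _ => ?_
      rw [S.cellAvg_colInd x (mem_indexPairs.1 hp).ne]
      split_ifs with h
      · rw [one_mul]
        exact h.le
      · rwa [zero_mul]
    refine (Finset.sum_le_sum fun a _ => h3 a).trans (le_of_eq ?_)
    rw [Finset.sum_const, Finset.card_univ, Fintype.card_fin, nsmul_eq_mul, mul_assoc]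
  have h4 : ((S.lowDensity ε).card : ℝ) ≤ ∑ p ∈ indexPairs t, ∑ x,
      if S.dens x p.1 p.2 (S.col x p.1 p.2 (x p.1) (x p.2)) < ε then (1 : ℝ) else 0 := by
    have hnn : ∀ (p : Fin t × Fin t) (x : ∀ i, X i),
        0 ≤ if S.dens x p.1 p.2 (S.col x p.1 p.2 (x p.1) (x p.2)) < ε then (1 : ℝ) else 0 :=
      fun p x => by split_ifs <;> norm_num
    rw [Finset.sum_comm, ← nsmul_one, ← Finset.sum_const]
    refine (Finset.sum_le_sum fun x hx => ?_).trans (Finset.sum_le_sum_of_subset_of_nonneg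
      (Finset.subset_univ _) fun x _ _ => Finset.sum_nonneg fun p _ => hnn p x)
    obtain ⟨i, j, hij, hlow⟩ := (Finset.mem_filter.1 hx).2
    refine le_trans ?_ (Finset.single_le_sum (fun p _ => hnn p x)
      (mem_indexPairs.2 hij : (i, j) ∈ indexPairs t))
    rw [if_pos hlow]
  refine h4.trans ((Finset.sum_le_sum h1).trans ?_)
  rw [Finset.sum_const, nsmul_eq_mul]
  have h5 : ((indexPairs t).card : ℝ) ≤ t ^ 2 := by exact_mod_cast card_indexPairs_le t
  have h6 : 0 ≤ M * ε * Fintype.card (∀ i, X i) := by positivity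
  calc _ ≤ t ^ 2 * (M * ε * Fintype.card (∀ i, X i)) := mul_le_mul_of_nonneg_right h5 h6
    _ = _ := by ring

theorem le_dens {ε : ℝ} {x : ∀ i, X i} (hx : x ∉ S.lowDensity ε) {i j : Fin t} (hij : i < j) :
    ε ≤ S.dens x i j (S.col x i j (x i) (x j)) := by
  classical
  by_contra! h
  exact hx (Finset.mem_filter.2 ⟨Finset.mem_univ x, i, j, hij, h⟩)

theorem pow_le_productDensity {ε : ℝ} (hε : 0 ≤ ε) (hε1 : ε ≤ 1) {x : ∀ i, X i}
    (hx : x ∉ S.lowDensity ε) : ε ^ (t ^ 2) ≤ (S.graph x).productDensity := by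
  have hcard : (Finset.univ : Finset {p : Fin t × Fin t // p.1 < p.2}).card ≤ t ^ 2 := by
    rw [Finset.card_univ]
    refine (Fintype.card_subtype_le _).trans (le_of_eq ?_)
    simp [sq]
  refine (pow_le_pow_of_le_one hε hε1 hcard).trans ?_
  rw [← Finset.prod_const]
  exact Finset.prod_le_prod (fun _ _ => hε) fun p _ => S.le_dens hx p.2

end ColoredCylinders

/-! ### From coloured cylinders to cylinder chain partitions -/

theorem PartiteGraph.productDensity_congr {Y Y' : ∀ i, Finset (X i)} (hY : Y = Y')
    {G : PartiteGraph Y} {G' : PartiteGraph Y'}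
    (hG : ∀ i j hij, G.edges i j hij = G'.edges i j hij) :
    G.productDensity = G'.productDensity := by
  subst hY
  obtain ⟨E, hE⟩ := G
  obtain ⟨E', hE'⟩ := G'
  obtain rfl : E = E' := by
    funext i j hij
    exact hG i j hij
  rfl

variable [∀ i, DecidableEq (X i)]

theorem IsQuasirandomPair.mono {α β : Type*} [DecidableEq α] [DecidableEq β] {A : Finset α}
    {B : Finset β} {E : Finset (α × β)} {c c' : ℝ} (h : IsQuasirandomPair A B E c) (hc : c ≤ c') :
    IsQuasirandomPair A B E c' :=
  le_trans (α := ℝ) h (by gcongr)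

theorem PartiteThreeGraph.isQuasirandomChain_congr (H : PartiteThreeGraph X)
    {Y Y' : ∀ i, Finset (X i)} (hY : Y = Y') {G : PartiteGraph Y} {G' : PartiteGraph Y'}
    (hG : ∀ i j hij, G.edges i j hij = G'.edges i j hij) (η : ℝ) (ψ : ℝ → ℝ) :
    H.IsQuasirandomChain G η ψ ↔ H.IsQuasirandomChain G' η ψ := by
  subst hY
  obtain ⟨E, hE⟩ := G
  obtain ⟨E', hE'⟩ := G'
  obtain rfl : E = E' := by
    funext i j hij
    exact hG i j hij
  rfl

variable [∀ i, Fintype (X i)]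

theorem holdsForFraction_of_card_le {η : ℝ} {p : (∀ i, X i) → Prop} (B : Finset (∀ i, X i))
    (hB : (B.card : ℝ) ≤ η * Fintype.card (∀ i, X i)) (h : ∀ x, x ∉ B → p x) :
    HoldsForFraction (1 - η) p := by
  classical
  rw [HoldsForFraction, Nat.card_eq_fintype_card, Nat.card_eq_fintype_card, Fintype.card_subtype]
  have h1 : (Bᶜ.card : ℝ) ≤ ((Finset.univ.filter p).card : ℝ) :=
    Nat.cast_le.2 (Finset.card_le_card fun x hx =>
      Finset.mem_filter.2 ⟨Finset.mem_univ x, h x (Finset.mem_compl.1 hx)⟩)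
  have h2 : (Bᶜ.card : ℝ) + B.card = Fintype.card (∀ i, X i) := by
    exact_mod_cast Finset.card_compl_add_card B
  linarith

namespace ColoredCylinders

variable {M : ℕ} (S : ColoredCylinders X M)

/-- The vertex cylinder partition into the cylinders of the tuples. -/
def toVertexPartition : VertexCylinderPartition X where
  parts := Finset.univ.image S.cyl
  nonempty Y hY i := by
    obtain ⟨x, -, rfl⟩ := Finset.mem_image.1 hY
    exact ⟨x i, S.mem_cyl x i⟩
  existsUnique_mem x := by
    refine ⟨S.cyl x, ⟨Finset.mem_image_of_mem _ (Finset.mem_univ x), S.mem_cyl x⟩, ?_⟩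
    rintro Y ⟨hY, hx⟩
    obtain ⟨y, -, rfl⟩ := Finset.mem_image.1 hY
    exact (S.cyl_eq y x hx).symm

open scoped Classical in
/-- The cylinder chain partition whose edge partitions are the partitions into colour classes. -/
noncomputable def toPartition : CylinderChainPartition X where
  vertex := S.toVertexPartition
  edge _ hY i j _ := Finpartition.ofSetSetoid
    (Setoid.ker fun p : X i × X j => S.col (Finset.mem_image.1 hY).choose i j p.1 p.2) _

theorem toPartition_cylinder (x : ∀ i, X i) : S.toPartition.vertex.cylinder x = S.cyl x :=
  (S.toPartition.vertex.existsUnique_mem x).unique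
    ⟨S.toPartition.vertex.cylinder_mem x, S.toPartition.vertex.mem_cylinder x⟩
    ⟨Finset.mem_image_of_mem _ (Finset.mem_univ x), S.mem_cyl x⟩

theorem toPartition_graph_edges (x : ∀ i, X i) (i j : Fin t) (hij : i < j) :
    (S.toPartition.graph x).edges i j hij = (S.graph x).edges i j hij := by
  classical
  have hmem := S.toPartition.vertex.cylinder_mem x
  have hcol : S.col (Finset.mem_image.1 hmem).choose = S.col x := by
    refine S.col_congr ?_
    rw [(Finset.mem_image.1 hmem).choose_spec.2, S.toPartition_cylinder]
  have hx : (x i, x j) ∈ S.cyl x i ×ˢ S.cyl x j :=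
    Finset.mem_product.2 ⟨S.mem_cyl x i, S.mem_cyl x j⟩
  ext p
  refine (Finpartition.mem_part_ofSetSetoid_iff_rel _).trans ?_
  change _ ∧ _ ∧ S.col (Finset.mem_image.1 hmem).choose i j (x i) (x j)
    = S.col (Finset.mem_image.1 hmem).choose i j p.1 p.2
      ↔ p ∈ S.edges x i j (S.col x i j (x i) (x j))
  rw [hcol, S.toPartition_cylinder, edges, Finset.mem_filter]
  simp only [hx, true_and]
  exact and_congr_right fun _ => eq_comm

theorem vertexSize_toPartition : S.toPartition.vertexSize = S.numCyl := rfl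

theorem edgeSize_toPartition_le : S.toPartition.edgeSize ≤ M := by
  classical
  refine Finset.sup_le fun Y _ => Finset.sup_le fun p _ => ?_
  have hsub : (S.toPartition.edge Y.1 Y.2 p.1.1 p.1.2 p.2).parts ⊆
      (Finset.univ : Finset (Fin M)).image fun a => (Y.1 p.1.1 ×ˢ Y.1 p.1.2).filter fun q =>
        a = S.col (Finset.mem_image.1 Y.2).choose p.1.1 p.1.2 q.1 q.2 := by
    intro s hs
    obtain ⟨q, -, rfl⟩ := Finset.mem_image.1 hs
    refine Finset.mem_image.2
      ⟨S.col (Finset.mem_image.1 Y.2).choose p.1.1 p.1.2 q.1 q.2, Finset.mem_univ _, ?_⟩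
    refine Finset.filter_congr fun r _ => Iff.rfl
  exact (Finset.card_le_card hsub).trans (Finset.card_image_le.trans (by simp))

variable (H : PartiteThreeGraph X)

theorem isQuasirandomChain_toPartition_iff (x : ∀ i, X i) (η : ℝ) (ψ : ℝ → ℝ) :
    H.IsQuasirandomChain (S.toPartition.graph x) η ψ ↔ H.IsQuasirandomChain (S.graph x) η ψ :=
  H.isQuasirandomChain_congr (S.toPartition_cylinder x) (S.toPartition_graph_edges x) η ψ

theorem productDensity_toPartition (x : ∀ i, X i) :
    (S.toPartition.graph x).productDensity = (S.graph x).productDensity :=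
  PartiteGraph.productDensity_congr (S.toPartition_cylinder x) (S.toPartition_graph_edges x)

/-! ### One step of the regularisation -/

/-- The chain of a tuple is quasirandom unless the tuple is in one of the three exceptional sets. -/
theorem isQuasirandomChain_graph {η ε c : ℝ} {s : ℕ} {ψ : ℝ → ℝ} {x : ∀ i, X i} (hε : 0 < ε)
    (hs : 1 ≤ ε ^ 6 * s) (hcε : c ≤ ((2 : ℝ)⁻¹ ^ 25 * (ε ^ 3) ^ 7) ^ 4)
    (hcψ : c ≤ ψ (S.graph x).productDensity) (h₁ : x ∉ S.badPairs c) (h₂ : x ∉ S.lowDensity ε)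
    (h₃ : x ∉ S.badTriads H η s) : H.IsQuasirandomChain (S.graph x) η ψ := by
  classical
  have hqr : ∀ (i j : Fin t) (a : Fin M), i < j →
      IsQuasirandomPair (S.cyl x i) (S.cyl x j) (S.edges x i j a) c := by
    intro i j a hij
    by_contra h
    exact h₁ (Finset.mem_filter.2 ⟨Finset.mem_univ x, i, j, a, hij, h⟩)
  refine ⟨fun i j k hij hjk => ?_, fun i j hij => (hqr i j _ hij).mono hcψ⟩
  by_contra hbad
  refine h₃ (Finset.mem_filter.2 ⟨Finset.mem_univ x, i, j, k, hij, hjk, ?_⟩)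
  have hδ : ε ^ 3 ≤ triadProduct (S.cyl x i) (S.cyl x j) (S.cyl x k)
      (S.edges x i j (S.col x i j (x i) (x j))) (S.edges x i k (S.col x i k (x i) (x k)))
      (S.edges x j k (S.col x j k (x j) (x k))) := by
    have d1 := S.le_dens h₂ hij
    have d2 := S.le_dens h₂ (hij.trans hjk)
    have d3 := S.le_dens h₂ hjk
    calc ε ^ 3 = ε * ε * ε := by ring
      _ ≤ _ := by
        rw [triadProduct]
        exact mul_le_mul (mul_le_mul d1 d2 hε.le (hε.le.trans d1)) d3 hε.le
          (mul_nonneg (hε.le.trans d1) (hε.le.trans d2))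
  have hc' := hcε.trans (by gcongr : ((2 : ℝ)⁻¹ ^ 25 * (ε ^ 3) ^ 7) ^ 4
    ≤ ((2 : ℝ)⁻¹ ^ 25 * triadProduct (S.cyl x i) (S.cyl x j) (S.cyl x k)
      (S.edges x i j (S.col x i j (x i) (x j))) (S.edges x i k (S.col x i k (x i) (x k)))
      (S.edges x j k (S.col x j k (x j) (x k))) ^ 7) ^ 4)
  refine ⟨lt_of_lt_of_le (by positivity) hδ, hs.trans ?_, (hqr i j _ hij).mono hc',
    (hqr i k _ (hij.trans hjk)).mono hc', (hqr j k _ hjk).mono hc', ?_⟩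
  · rw [show ε ^ 6 = (ε ^ 3) ^ 2 by ring]
    gcongr
  · refine lt_of_eq_of_lt ?_ (not_le.1 hbad)
    rw [Finset.card_product, Finset.card_product]
    push_cast
    simp only [PartiteGraph.density, triadProduct, graph]
    ring

/-- Regularise the vertices; then either the chain is quasirandom for most tuples, or the edge
partitions can be refined with a gain of `η³ / 6` in the normalised potential. -/
theorem exists_regular_or_refinement {η ε c : ℝ} {s n M' : ℕ} (hη : 0 < η) (hc : 0 < c)
    (hε : 0 ≤ ε) (htε : t ^ 2 * M * ε ≤ η / 4) (hn : (t : ℝ) ^ 2 ≤ n * (c ^ 2 * (η / 4)))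
    (hM' : M * 16 ^ (3 * s * t * M ^ 3) ≤ M') :
    ∃ S₁ : ColoredCylinders X M, S₁.numCyl ≤ S.numCyl * (4 ^ (t * M * t)) ^ n ∧
      ((∃ B : Finset (∀ i, X i), (B.card : ℝ) ≤ η * Fintype.card (∀ i, X i) ∧
        ∀ x ∉ B, x ∉ S₁.badPairs c ∧ x ∉ S₁.lowDensity ε ∧ x ∉ S₁.badTriads H η s) ∨
      ∃ S₂ : ColoredCylinders X M', S₂.numCyl = S₁.numCyl ∧
        S₂.tripleResidual H < S.tripleResidual H ∧
        S₂.tripleResidual H ≤ S.tripleResidual H - η ^ 3 / 6 * Fintype.card (∀ i, X i)) := by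
  classical
  obtain ⟨S₁, hcol, hcyl, hnum, hbad⟩ := S.exists_vertex_regular hc (by positivity : 0 ≤ η / 4) n (by
    refine S.pairResidual_le.trans ?_
    have := mul_le_mul_of_nonneg_right hn (Nat.cast_nonneg (Fintype.card (∀ i, X i)) : (0 : ℝ) ≤ _)
    linarith)
  refine ⟨S₁, hnum, ?_⟩
  set B := S₁.badPairs c ∪ S₁.lowDensity ε ∪ S₁.badTriads H η s with hB
  by_cases hBcard : (B.card : ℝ) ≤ η * Fintype.card (∀ i, X i)
  · left
    refine ⟨B, hBcard, fun x hx => ?_⟩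
    simp only [hB, Finset.mem_union, not_or] at hx
    exact ⟨hx.1.1, hx.1.2, hx.2⟩
  · right
    obtain ⟨S₂, hcyl₂, hres⟩ := S₁.exists_recolor H hη s hM'
    have hmono := tripleResidual_mono H hcol hcyl
    have hlow := S₁.card_lowDensity_le hε
    have hlow' := mul_le_mul_of_nonneg_right htε
      (Nat.cast_nonneg (Fintype.card (∀ i, X i)) : (0 : ℝ) ≤ _)
    have hunion : (B.card : ℝ) ≤ (S₁.badPairs c).card + (S₁.lowDensity ε).card
        + (S₁.badTriads H η s).card := by
      exact_mod_cast (Finset.card_union_le _ _).trans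
        (Nat.add_le_add_right (Finset.card_union_le _ _) _)
    have hcardnn : (0 : ℝ) ≤ η * Fintype.card (∀ i, X i) := by positivity
    have hbig : η / 2 * Fintype.card (∀ i, X i) < (S₁.badTriads H η s).card := by
      linarith [not_le.1 hBcard]
    have hη2 : 0 < η ^ 2 / 3 := by positivity
    have hgain := mul_lt_mul_of_pos_left hbig hη2
    refine ⟨S₂, by rw [numCyl, numCyl, hcyl₂], ?_, ?_⟩
    · have : 0 ≤ η ^ 2 / 3 * (η / 2 * Fintype.card (∀ i, X i)) := by positivity
      linarith
    · linarith

end ColoredCylinders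

/-! ### Polynomials near zero -/

/-- A polynomial that is nonnegative and increasing on `(0, 1)` cannot decay too fast at `0`: compare
its value at `a` with its Lagrange interpolation at equally spaced nodes in `(0, y]`. -/
theorem eval_le_mul_eval {ψ : Polynomial ℝ}
    (hmono : MonotoneOn (fun x => ψ.eval x) (Set.Ioo (0 : ℝ) 1))
    (hpos : ∀ x ∈ Set.Ioo (0 : ℝ) 1, 0 ≤ ψ.eval x) {y a : ℝ} (hy : 0 < y) (hya : y ≤ a)
    (ha : a < 1) :
    ψ.eval a ≤ (ψ.natDegree + 1) * ((ψ.natDegree + 1) / y) ^ ψ.natDegree * ψ.eval y := by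
  set D := ψ.natDegree with hD
  set v : ℕ → ℝ := fun j => (j + 1) * (y / (D + 1)) with hv
  have hstep : 0 < y / (D + 1) := by positivity
  have hvpos : ∀ j, 0 < v j := fun j => by positivity
  have hvle : ∀ j ∈ Finset.range (D + 1), v j ≤ y := by
    intro j hj
    have : ((j : ℝ) + 1) ≤ D + 1 := by exact_mod_cast Finset.mem_range.1 hj
    calc ((j : ℝ) + 1) * (y / (D + 1)) ≤ (D + 1) * (y / (D + 1)) := by gcongr
      _ = y := mul_div_cancel₀ y (by positivity)
  have hinj : Set.InjOn v (Finset.range (D + 1) : Finset ℕ) := by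
    intro i _ j _ hij
    have := mul_right_cancel₀ hstep.ne' hij
    exact_mod_cast add_right_cancel this
  have hint := Lagrange.eq_interpolate (f := ψ) hinj (by
    rw [Finset.card_range]
    exact Polynomial.degree_le_natDegree.trans_lt (by exact_mod_cast Nat.lt_succ_self D))
  have hbasis : ∀ i ∈ Finset.range (D + 1),
      |(Lagrange.basis (Finset.range (D + 1)) v i).eval a| ≤ ((D + 1) / y) ^ D := by
    intro i hi
    rw [Lagrange.basis, Polynomial.eval_prod, Finset.abs_prod]
    have hcard : ((Finset.range (D + 1)).erase i).card = D := by
      rw [Finset.card_erase_of_mem hi, Finset.card_range, Nat.add_sub_cancel]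
    rw [← hcard, ← Finset.prod_const, hcard]
    refine Finset.prod_le_prod (fun _ _ => abs_nonneg _) fun j hj => ?_
    obtain ⟨hji, hj'⟩ := Finset.mem_erase.1 hj
    have h1 : |a - v j| ≤ 1 := by
      rw [abs_le]
      have := hvpos j
      have := hvle j hj'
      constructor <;> linarith
    have h2 : y / (D + 1) ≤ |v i - v j| := by
      have h3 : v i - v j = ((i : ℤ) - (j : ℤ) : ℤ) * (y / (D + 1)) := by
        simp only [hv]
        push_cast
        ring
      have h4 : (1 : ℝ) ≤ |(((i : ℤ) - (j : ℤ) : ℤ) : ℝ)| := by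
        rw [← Int.cast_abs]
        have h5 : (i : ℤ) - (j : ℤ) ≠ 0 := sub_ne_zero.2 (Nat.cast_injective.ne hji.symm)
        exact Int.cast_one.symm.trans_le (Int.cast_le.2 (Int.one_le_abs h5))
      rw [h3, abs_mul, abs_of_pos hstep]
      exact le_mul_of_one_le_left hstep.le h4
    simp only [Lagrange.basisDivisor, Polynomial.eval_mul, Polynomial.eval_C, Polynomial.eval_sub,
      Polynomial.eval_X, abs_mul, abs_inv]
    calc |v i - v j|⁻¹ * |a - v j| ≤ (y / (D + 1))⁻¹ * 1 := by gcongr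
      _ = (D + 1) / y := by rw [mul_one, inv_div]
  have hval : ∀ i ∈ Finset.range (D + 1), |ψ.eval (v i)| ≤ ψ.eval y := by
    intro i hi
    have hmem : v i ∈ Set.Ioo (0 : ℝ) 1 := ⟨hvpos i, (hvle i hi).trans_lt (hya.trans_lt ha)⟩
    rw [abs_of_nonneg (hpos _ hmem)]
    exact hmono hmem ⟨hy, hya.trans_lt ha⟩ (hvle i hi)
  have hy0 : 0 ≤ ψ.eval y := hpos y ⟨hy, hya.trans_lt ha⟩
  calc ψ.eval a = ∑ i ∈ Finset.range (D + 1),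
        ψ.eval (v i) * (Lagrange.basis (Finset.range (D + 1)) v i).eval a := by
        conv_lhs => rw [hint]
        simp [Lagrange.interpolate_apply, Polynomial.eval_finsetSum]
    _ ≤ ∑ i ∈ Finset.range (D + 1), ψ.eval y * ((D + 1) / y) ^ D := by
        refine Finset.sum_le_sum fun i hi => (le_abs_self _).trans ?_
        rw [abs_mul]
        exact mul_le_mul (hval i hi) (hbasis i hi) (abs_nonneg _) hy0
    _ = _ := by
        rw [Finset.sum_const, Finset.card_range, nsmul_eq_mul]
        push_cast
        ring

/-! ### Towers -/

theorem le_two_rpow (x : ℝ) : x ≤ (2 : ℝ) ^ x := by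
  rcases le_or_gt x 0 with h | h
  · exact h.trans (by positivity)
  · have h1 : ((⌊x⌋₊ : ℕ) : ℝ) + 1 ≤ 2 ^ ⌊x⌋₊ := by exact_mod_cast Nat.lt_two_pow_self
    calc x ≤ ⌊x⌋₊ + 1 := (Nat.lt_floor_add_one x).le
      _ ≤ (2 : ℝ) ^ ⌊x⌋₊ := h1
      _ = (2 : ℝ) ^ ((⌊x⌋₊ : ℕ) : ℝ) := (Real.rpow_natCast _ _).symm
      _ ≤ (2 : ℝ) ^ x := Real.rpow_le_rpow_of_exponent_le one_le_two (Nat.floor_le h.le)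

theorem twr_mono (n : ℕ) {x y : ℝ} (h : x ≤ y) : twr n x ≤ twr n y := by
  induction n with
  | zero => exact h
  | succ n ih => exact Real.rpow_le_rpow_of_exponent_le one_le_two ih

theorem le_twr (n : ℕ) (x : ℝ) : x ≤ twr n x := by
  induction n with
  | zero => exact le_rfl
  | succ n ih => exact ih.trans (le_two_rpow _)

theorem twr_add (m n : ℕ) (x : ℝ) : twr (m + n) x = twr m (twr n x) := by
  induction m with
  | zero => rw [Nat.zero_add]; rfl
  | succ m ih => rw [Nat.succ_add, twr, twr, ih]

theorem twr_le_twr {m n : ℕ} (h : m ≤ n) (x : ℝ) : twr m x ≤ twr n x := by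
  obtain ⟨k, rfl⟩ := Nat.exists_eq_add_of_le h
  rw [twr_add]
  exact twr_mono m (le_twr k x)

theorem two_rpow_pow (x : ℝ) (n : ℕ) : ((2 : ℝ) ^ x) ^ n = 2 ^ (x * n) := by
  rw [Real.rpow_mul zero_le_two, Real.rpow_natCast]

theorem pow_le_two_rpow_mul {x : ℝ} (hx : 0 ≤ x) (n : ℕ) : x ^ n ≤ 2 ^ (x * n) := by
  rw [← two_rpow_pow]
  exact pow_le_pow_left₀ hx (le_two_rpow x) n

theorem two_rpow_mono {x y : ℝ} (h : x ≤ y) : (2 : ℝ) ^ x ≤ 2 ^ y :=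
  Real.rpow_le_rpow_of_exponent_le one_le_two h

theorem pow_le_two_two_rpow {L : ℝ} (hL : 100 ≤ L) {n : ℕ} (hn : n ≤ 100) :
    L ^ n ≤ 2 ^ (2 : ℝ) ^ L := by
  refine (pow_le_two_rpow_mul (by linarith) n).trans (two_rpow_mono ?_)
  have hn' : (n : ℝ) ≤ 100 := by exact_mod_cast hn
  have h1 : L / 2 ≤ 2 ^ (L / 2) := le_two_rpow _
  have h2 : (2 : ℝ) ^ (50 : ℝ) ≤ 2 ^ (L / 2) := two_rpow_mono (by linarith)
  have h3 : (200 : ℝ) ≤ 2 ^ (50 : ℝ) := by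
    rw [show (50 : ℝ) = ((50 : ℕ) : ℝ) by norm_num, Real.rpow_natCast]
    norm_num
  calc L * n ≤ L * 100 := by gcongr
    _ = L / 2 * 200 := by ring
    _ ≤ 2 ^ (L / 2) * 2 ^ (L / 2) := mul_le_mul h1 (h3.trans h2) (by norm_num) (by positivity)
    _ = 2 ^ L := by rw [← Real.rpow_add two_pos, add_halves]

/-! ### Growth of the parameters in one step -/

/-- The parameters of a step of the regularisation: `b = t² / η`, `M` is the number of colours, and
the number of samples is about `(4 b M)⁶`, so that the number of colours grows by at most three
exponentials. -/
theorem colors_growth {L b : ℝ} {t M s : ℕ} (hL : 100 ≤ L) (hb0 : 0 ≤ b) (hbL : b ≤ L)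
    (htb : (t : ℝ) ≤ b) (hM : (M : ℝ) ≤ L) (hs : (s : ℝ) ≤ (4 * b * M) ^ 6 + 1) :
    ((M * 16 ^ (3 * s * t * M ^ 3) : ℕ) : ℝ) ≤ twr 4 L := by
  have hL0 : 0 ≤ L := by linarith
  have hs' : (s : ℝ) ≤ L ^ 19 := by
    have h1 : 4 * b * M ≤ L ^ 3 := by
      calc 4 * b * M ≤ L * L * L := by gcongr; linarith
        _ = L ^ 3 := by ring
    calc (s : ℝ) ≤ (4 * b * M) ^ 6 + 1 := hs
      _ ≤ (L ^ 3) ^ 6 + 1 := by gcongr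
      _ = L ^ 18 * 1 + 1 := by ring
      _ ≤ L ^ 18 * 1 + L ^ 18 := by gcongr; exact one_le_pow₀ (by linarith)
      _ = L ^ 18 * 2 := by ring
      _ ≤ L ^ 18 * L := by gcongr; linarith
      _ = L ^ 19 := by ring
  have hexp : (4 : ℝ) * (3 * s * t * M ^ 3 : ℕ) ≤ L ^ 24 := by
    push_cast
    calc (4 : ℝ) * (3 * s * t * M ^ 3) = 12 * (s * t * M ^ 3) := by ring
      _ ≤ L * (L ^ 19 * L * L ^ 3) := by gcongr <;> linarith
      _ = L ^ 24 := by ring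
  have h16 : (16 : ℝ) ^ (3 * s * t * M ^ 3) ≤ 2 ^ (L ^ 24) := by
    rw [show (16 : ℝ) = 2 ^ (4 : ℝ) by
      rw [show (4 : ℝ) = ((4 : ℕ) : ℝ) by norm_num, Real.rpow_natCast]; norm_num, two_rpow_pow]
    exact two_rpow_mono hexp
  push_cast
  calc (M : ℝ) * 16 ^ (3 * s * t * M ^ 3) ≤ 2 ^ L * 2 ^ (L ^ 24) :=
        mul_le_mul (hM.trans (le_two_rpow L)) h16 (by positivity) (by positivity)
    _ = 2 ^ (L + L ^ 24) := (Real.rpow_add two_pos _ _).symm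
    _ ≤ 2 ^ (L ^ 25) := two_rpow_mono (by
        calc L + L ^ 24 = L ^ 1 * 1 + L ^ 24 := by ring
          _ ≤ L ^ 24 * 1 + L ^ 24 := by gcongr <;> linarith
          _ = L ^ 24 * 2 := by ring
          _ ≤ L ^ 24 * L := by gcongr; linarith
          _ = L ^ 25 := by ring)
    _ ≤ twr 3 L := two_rpow_mono (pow_le_two_two_rpow hL (by norm_num))
    _ ≤ twr 4 L := twr_le_twr (by norm_num) L

/-- The number of cylinders grows by at most four exponentials in a step: the reciprocal of the
quasirandomness parameter `c` is at most exponential in a power of `L`, and the number of cylinders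
is multiplied by an exponential of a power of that. -/
theorem cylinders_growth {L b c y p : ℝ} {t M K D n : ℕ} (hL : 100 ≤ L) (hbL : b ≤ L)
    (htb : (t : ℝ) ^ 2 ≤ b) (hM : (M : ℝ) ≤ L) (hK : (K : ℝ) ≤ L) (hD : (D : ℝ) ≤ L) (hp0 : 0 < p)
    (hp : p⁻¹ ≤ L) (hc : 0 < c) (hy0 : 0 < y) (hy : y⁻¹ ≤ (4 * b * M) ^ (t ^ 2 + 3))
    (hpc : p ≤ (D + 1) * ((D + 1) / y) ^ D * c) (hn : (n : ℝ) ≤ 4 * b / c ^ 2 + 1) :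
    ((K * (4 ^ (t * M * t)) ^ n : ℕ) : ℝ) ≤ twr 4 L := by
  have hL0 : 0 ≤ L := by linarith
  have hL1 : 1 ≤ L := by linarith
  have hb0 : 0 ≤ b := le_trans (by positivity) htb
  have hpowle : ∀ {m k : ℕ}, m ≤ k → L ^ m ≤ L ^ k := fun h => pow_le_pow_right₀ hL1 h
  have hy' : y⁻¹ ≤ 2 ^ (L ^ 6) := by
    have h1 : 4 * b * M ≤ L ^ 3 := by
      calc 4 * b * M ≤ L * L * L := by gcongr; linarith
        _ = L ^ 3 := by ring
    refine hy.trans ((pow_le_pow_left₀ (by positivity) h1 _).trans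
      ((pow_le_two_rpow_mul (by positivity) _).trans (two_rpow_mono ?_)))
    push_cast
    calc L ^ 3 * ((t : ℝ) ^ 2 + 3) ≤ L ^ 3 * (L + L) := by
          gcongr
          · exact htb.trans hbL
          · linarith
      _ = L ^ 4 * 2 := by ring
      _ ≤ L ^ 4 * L ^ 2 := by gcongr; nlinarith
      _ = L ^ 6 := by ring
  have hD1 : (D : ℝ) + 1 ≤ 2 ^ L := by
    have h1 : (D : ℝ) + 1 ≤ L + 1 := by linarith
    have h2 : L / 2 ≤ 2 ^ (L / 2) := le_two_rpow _
    have h3 : (2 : ℝ) ^ L = 2 ^ (L / 2) * 2 ^ (L / 2) := by rw [← Real.rpow_add two_pos, add_halves]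
    rw [h3]
    nlinarith
  have hc' : c⁻¹ ≤ 2 ^ (L ^ 9) := by
    have h1 : c⁻¹ ≤ p⁻¹ * ((D + 1) * ((D + 1) / y) ^ D) := by
      rw [inv_mul_eq_div, le_div_iff₀ hp0, ← div_eq_inv_mul, div_le_iff₀ hc]
      exact hpc
    have h2 : ((D : ℝ) + 1) / y ≤ 2 ^ (L ^ 7) := by
      rw [div_eq_mul_inv]
      calc ((D : ℝ) + 1) * y⁻¹ ≤ 2 ^ L * 2 ^ (L ^ 6) := by gcongr
        _ = 2 ^ (L + L ^ 6) := (Real.rpow_add two_pos _ _).symm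
        _ ≤ 2 ^ (L ^ 7) := two_rpow_mono (by
            have := hpowle (show 1 ≤ 6 by norm_num)
            have h7 : L ^ 6 * 2 ≤ L ^ 6 * L := by gcongr; linarith
            nlinarith)
    have h3 : (((D : ℝ) + 1) / y) ^ D ≤ 2 ^ (L ^ 8) := by
      refine (pow_le_pow_left₀ (by positivity) h2 D).trans ?_
      rw [two_rpow_pow]
      refine two_rpow_mono ?_
      calc L ^ 7 * D ≤ L ^ 7 * L := by gcongr
        _ = L ^ 8 := by ring
    calc c⁻¹ ≤ p⁻¹ * ((D + 1) * ((D + 1) / y) ^ D) := h1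
      _ ≤ 2 ^ L * (2 ^ L * 2 ^ (L ^ 8)) := by
          gcongr
          exact hp.trans (le_two_rpow L)
      _ = 2 ^ (L + (L + L ^ 8)) := by rw [Real.rpow_add two_pos, Real.rpow_add two_pos]
      _ ≤ 2 ^ (L ^ 9) := two_rpow_mono (by
          have := hpowle (show 1 ≤ 8 by norm_num)
          have h7 : L ^ 8 * 3 ≤ L ^ 8 * L := by gcongr; linarith
          nlinarith)
  have hn' : (n : ℝ) ≤ 2 ^ (L ^ 11) := by
    have h1 : 4 * b / c ^ 2 ≤ 2 ^ (L ^ 2 + L ^ 9 * 2) := by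
      rw [div_eq_mul_inv, ← inv_pow, Real.rpow_add two_pos]
      refine mul_le_mul ?_ ?_ (by positivity) (by positivity)
      · calc 4 * b ≤ L * L := by gcongr; linarith
          _ = L ^ 2 := by ring
          _ ≤ _ := le_two_rpow _
      · refine (pow_le_pow_left₀ (by positivity) hc' 2).trans ?_
        rw [two_rpow_pow]
        norm_num
    have h2 : (1 : ℝ) ≤ 2 ^ (L ^ 2 + L ^ 9 * 2) := Real.one_le_rpow one_le_two (by positivity)
    calc (n : ℝ) ≤ 2 ^ (L ^ 2 + L ^ 9 * 2) * 2 := by linarith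
      _ = 2 ^ (L ^ 2 + L ^ 9 * 2 + 1) := by rw [Real.rpow_add two_pos _ 1, Real.rpow_one]
      _ ≤ 2 ^ (L ^ 11) := two_rpow_mono (by
          have := hpowle (show 2 ≤ 9 by norm_num)
          have h8 : (1 : ℝ) ≤ L ^ 9 := one_le_pow₀ hL1
          have h7 : L ^ 9 * 4 ≤ L ^ 9 * L ^ 2 := by gcongr; nlinarith
          have h9 : L ^ 11 = L ^ 9 * L ^ 2 := by ring
          linarith)
  have hexp : (2 : ℝ) * (t * M * t * n : ℕ) ≤ 2 ^ (L ^ 12) := by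
    push_cast
    have h1 : (2 : ℝ) * (t * M * t) ≤ 2 ^ (L ^ 3) := by
      refine le_trans ?_ (le_two_rpow _)
      calc (2 : ℝ) * (t * M * t) = 2 * ((t : ℝ) ^ 2 * M) := by ring
        _ ≤ L * (L * L) := by
            gcongr
            · linarith
            · exact htb.trans hbL
        _ = L ^ 3 := by ring
    calc (2 : ℝ) * (t * M * t * n) = 2 * (t * M * t) * n := by ring
      _ ≤ 2 ^ (L ^ 3) * 2 ^ (L ^ 11) := by gcongr
      _ = 2 ^ (L ^ 3 + L ^ 11) := (Real.rpow_add two_pos _ _).symm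
      _ ≤ 2 ^ (L ^ 12) := two_rpow_mono (by
          have := hpowle (show 3 ≤ 11 by norm_num)
          have h7 : L ^ 11 * 2 ≤ L ^ 11 * L := by gcongr; linarith
          nlinarith)
  have hmain : ((4 : ℝ) ^ (t * M * t)) ^ n ≤ 2 ^ (2 : ℝ) ^ (L ^ 12) := by
    rw [← pow_mul, show (4 : ℝ) = 2 ^ (2 : ℝ) by norm_num, two_rpow_pow]
    exact two_rpow_mono hexp
  push_cast
  calc (K : ℝ) * (4 ^ (t * M * t)) ^ n ≤ 2 ^ (2 : ℝ) ^ (L ^ 12) * 2 ^ (2 : ℝ) ^ (L ^ 12) := by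
        refine mul_le_mul ?_ hmain (by positivity) (by positivity)
        refine (hK.trans ?_).trans (le_two_rpow _)
        exact ((pow_one L).symm.le.trans (hpowle (by norm_num))).trans (le_two_rpow _)
    _ = 2 ^ ((2 : ℝ) ^ (L ^ 12) * 2) := by rw [← Real.rpow_add two_pos, mul_two]
    _ = 2 ^ (2 : ℝ) ^ (L ^ 12 + 1) := by rw [Real.rpow_add two_pos _ 1, Real.rpow_one]
    _ ≤ 2 ^ (2 : ℝ) ^ (L ^ 13) := two_rpow_mono (two_rpow_mono (by
        have h1 : (1 : ℝ) ≤ L ^ 12 := one_le_pow₀ hL1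
        have h7 : L ^ 12 * 2 ≤ L ^ 12 * L := by gcongr; linarith
        nlinarith))
    _ ≤ twr 4 L := two_rpow_mono (two_rpow_mono (pow_le_two_two_rpow hL (by norm_num)))

/-! ### The regularisation -/

theorem eval_le_eval_of_le_one {ψ : Polynomial ℝ}
    (hmono : MonotoneOn (fun x => ψ.eval x) (Set.Ioo (0 : ℝ) 1)) {y z : ℝ} (hy : 0 < y)
    (hy1 : y < 1) (hyz : y ≤ z) (hz : z ≤ 1) : ψ.eval y ≤ ψ.eval z := by
  rcases hz.lt_or_eq with hz | rfl
  · exact hmono ⟨hy, hy1⟩ ⟨hy.trans_le hyz, hz⟩ hyz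
  · have hlim : Filter.Tendsto (fun x => ψ.eval x) (nhdsWithin 1 (Set.Iio 1)) (nhds (ψ.eval 1)) :=
      ψ.continuous.continuousAt.tendsto.mono_left nhdsWithin_le_nhds
    refine ge_of_tendsto hlim ?_
    filter_upwards [Ioo_mem_nhdsLT hy1] with x hx
    exact hmono ⟨hy, hy1⟩ ⟨hy.trans hx.1, hx.2⟩ hx.1.le

namespace ColoredCylinders

/-- The iteration of the regularisation step: `N` bounds the potential in units of the gain of a
step, so that the loop ends after at most `N` refinements of the edge partitions. -/
theorem exists_quasirandom {η : ℝ} (hη : 0 < η) (hη1 : η < 1) (ht : 1 ≤ t) {ψ : Polynomial ℝ}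
    (hψ_maps : ∀ x ∈ Set.Ioo (0 : ℝ) 1, ψ.eval x ∈ Set.Ioo (0 : ℝ) 1)
    (hψ_mono : MonotoneOn (fun x => ψ.eval x) (Set.Ioo (0 : ℝ) 1))
    (hψ_le : ∀ x ∈ Set.Ioo (0 : ℝ) 1, ψ.eval x ≤ (2 : ℝ) ^ (-100 : ℤ) * x ^ 28)
    (H : PartiteThreeGraph X) (N : ℕ) {M : ℕ} (S : ColoredCylinders X M) {L L' : ℝ}
    (hM : 1 ≤ M) (hL : 100 ≤ L) (hLL : L ≤ L') (hb : (t : ℝ) ^ 2 / η ≤ L)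
    (hp : (ψ.eval (η / (t : ℝ) ^ 2))⁻¹ ≤ L') (hD : (ψ.natDegree : ℝ) ≤ L') (hML : (M : ℝ) ≤ L)
    (hKL : (S.numCyl : ℝ) ≤ L')
    (hN : S.tripleResidual H ≤ N * (η ^ 3 / 6 * Fintype.card (∀ i, X i))) :
    ∃ (M' : ℕ) (S' : ColoredCylinders X M'),
      S'.toPartition.IsQuasirandom H η (fun x => ψ.eval x) ∧
      (M' : ℝ) ≤ twr (4 * N) L ∧ (S'.numCyl : ℝ) ≤ twr (4 * (N + 1)) L' := by
  have ht' : (1 : ℝ) ≤ t := by exact_mod_cast ht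
  have hM' : (1 : ℝ) ≤ M := by exact_mod_cast hM
  have ht2 : (0 : ℝ) < (t : ℝ) ^ 2 := by positivity
  set b : ℝ := (t : ℝ) ^ 2 / η with hb_def
  have hb0 : 0 < b := by positivity
  have htb : (t : ℝ) ^ 2 ≤ b := by
    rw [hb_def, le_div_iff₀ hη]
    exact mul_le_of_le_one_right ht2.le hη1.le
  have htb' : (t : ℝ) ≤ b := (le_self_pow₀ ht' two_ne_zero).trans htb
  set ε : ℝ := η / (4 * t ^ 2 * M) with hε_def
  have hε : 0 < ε := by positivity
  have hεinv : ε⁻¹ = 4 * b * M := by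
    rw [hε_def, hb_def, inv_div]
    ring
  have hεa : ε ≤ η / (t : ℝ) ^ 2 := by
    rw [hε_def]
    refine div_le_div_of_nonneg_left hη.le ht2 ?_
    nlinarith
  have ha1 : η / (t : ℝ) ^ 2 < 1 := by
    rw [div_lt_one ht2]
    nlinarith
  have hε1 : ε < 1 := hεa.trans_lt ha1
  -- The exponent `t² + 3` makes `y` smaller both than the product density of a chain with
  -- densities at least `ε` and than `ε ^ 3`.
  set y : ℝ := ε ^ (t ^ 2 + 3) with hy_def
  have hy : 0 < y := by positivity
  have hyε : y ≤ ε ^ 3 := pow_le_pow_of_le_one hε.le hε1.le (by omega)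
  have hyε' : y ≤ ε ^ (t ^ 2) := pow_le_pow_of_le_one hε.le hε1.le (by omega)
  have hyle : y ≤ ε := hyε.trans (pow_le_of_le_one hε.le hε1.le (by norm_num))
  have hy1 : y < 1 := hyle.trans_lt hε1
  set c : ℝ := ψ.eval y with hc_def
  have hc : 0 < c := (hψ_maps y ⟨hy, hy1⟩).1
  set s : ℕ := ⌈(ε ^ 6)⁻¹⌉₊ with hs_def
  have hs : 1 ≤ ε ^ 6 * s := by
    have := mul_le_mul_of_nonneg_left (Nat.le_ceil ((ε ^ 6)⁻¹)) (by positivity : 0 ≤ ε ^ 6)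
    rwa [mul_inv_cancel₀ (by positivity)] at this
  have hs' : (s : ℝ) ≤ (4 * b * M) ^ 6 + 1 := by
    rw [← hεinv, inv_pow]
    exact (Nat.ceil_lt_add_one (by positivity)).le
  set n : ℕ := ⌈4 * b / c ^ 2⌉₊ with hn_def
  have hn : (t : ℝ) ^ 2 ≤ n * (c ^ 2 * (η / 4)) := by
    calc (t : ℝ) ^ 2 = 4 * b / c ^ 2 * (c ^ 2 * (η / 4)) := by
          rw [hb_def]
          field_simp
      _ ≤ _ := mul_le_mul_of_nonneg_right (Nat.le_ceil _) (by positivity)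
  have hn' : (n : ℝ) ≤ 4 * b / c ^ 2 + 1 := (Nat.ceil_lt_add_one (by positivity)).le
  have hcε : c ≤ ((2 : ℝ)⁻¹ ^ 25 * (ε ^ 3) ^ 7) ^ 4 := by
    calc c ≤ (2 : ℝ) ^ (-100 : ℤ) * y ^ 28 := hψ_le y ⟨hy, hy1⟩
      _ ≤ (2 : ℝ) ^ (-100 : ℤ) * (ε ^ 3) ^ 28 := by gcongr
      _ = _ := by
        have h2 : (2 : ℝ) ^ (-100 : ℤ) = (2 : ℝ)⁻¹ ^ 100 := by
          rw [zpow_neg, inv_pow]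
          norm_cast
        rw [h2]
        ring
  have hpc := eval_le_mul_eval hψ_mono (fun x hx => (hψ_maps x hx).1.le) hy (hyle.trans hεa) ha1
  have hp0 : 0 < ψ.eval (η / (t : ℝ) ^ 2) := (hψ_maps _ ⟨by positivity, ha1⟩).1
  have hyinv : y⁻¹ ≤ (4 * b * M) ^ (t ^ 2 + 3) := by rw [hy_def, ← inv_pow, hεinv]
  have hcol := colors_growth hL hb0.le hb htb' hML hs'
  have hcyl := cylinders_growth (hL.trans hLL) (hb.trans hLL) htb (hML.trans hLL) hKL hD hp0 hp hc
    hy hyinv hpc hn'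
  obtain ⟨S₁, hnum, hcase⟩ := S.exists_regular_or_refinement H hη hc hε.le
    (le_of_eq (by rw [hε_def]; field_simp)) hn le_rfl (s := s)
  have hnum' : (S₁.numCyl : ℝ) ≤ twr 4 L' := (Nat.cast_le.2 hnum).trans hcyl
  rcases hcase with ⟨B, hB, hreg⟩ | ⟨S₂, hnum₂, hlt, hres⟩
  · refine ⟨M, S₁, ?_, hML.trans (le_twr _ _), hnum'.trans (twr_le_twr (by omega) _)⟩
    refine holdsForFraction_of_card_le B hB fun x hx => ?_
    obtain ⟨h1, h2, h3⟩ := hreg x hx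
    rw [isQuasirandomChain_toPartition_iff]
    refine S₁.isQuasirandomChain_graph H hε hs hcε ?_ h1 h2 h3
    exact eval_le_eval_of_le_one hψ_mono hy hy1
      (hyε'.trans (S₁.pow_le_productDensity hε.le hε1.le h2)) (S₁.productDensity_le_one x)
  · cases N with
    | zero =>
      have := S₂.tripleResidual_nonneg H
      simp only [Nat.cast_zero, zero_mul] at hN
      linarith
    | succ N =>
      obtain ⟨M', S', hqr, hE, hV⟩ := exists_quasirandom hη hη1 ht hψ_maps hψ_mono hψ_le H N S₂
        (L := twr 4 L) (L' := twr 4 L')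
        (Nat.one_le_iff_ne_zero.2 (Nat.mul_ne_zero (by omega) (by positivity)))
        (hL.trans (le_twr _ _)) (twr_mono 4 hLL) (hb.trans (le_twr _ _)) (hp.trans (le_twr _ _))
        (hD.trans (le_twr _ _)) hcol (hnum₂ ▸ hnum') (by
          push_cast at hN
          linarith)
      rw [← twr_add] at hE hV
      exact ⟨M', S', hqr, hE.trans (twr_le_twr (by omega) _), hV.trans (twr_le_twr (by omega) _)⟩

/-- The trivial partition into one cylinder and complete bipartite graphs. -/
def trivial (X : Fin t → Type u) [∀ i, Fintype (X i)] : ColoredCylinders X 1 where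
  cyl _ _ := Finset.univ
  col _ _ _ _ _ := 0
  mem_cyl _ _ := Finset.mem_univ _
  cyl_eq _ _ _ := rfl
  col_eq _ _ _ := rfl

theorem numCyl_trivial_le : (trivial X).numCyl ≤ 1 :=
  (Finset.card_le_card (Finset.image_subset_iff.2 fun _ _ =>
    Finset.mem_singleton_self (fun _ => Finset.univ))).trans (Finset.card_singleton _).le

end ColoredCylinders

end CylinderRegularity

theorem theorem2 (t : ℕ) (η : ℝ) (hη : 0 < η) (hηt : η < (t : ℝ) ^ 2)
    (ψ : Polynomial ℝ)
    (hψ_maps : ∀ x ∈ Set.Ioo (0 : ℝ) 1, ψ.eval x ∈ Set.Ioo (0 : ℝ) 1)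
    (hψ_mono : MonotoneOn (fun x => ψ.eval x) (Set.Ioo (0 : ℝ) 1))
    (hψ_le : ∀ x ∈ Set.Ioo (0 : ℝ) 1, ψ.eval x ≤ (2 : ℝ) ^ (-100 : ℤ) * x ^ 28) :
    ∃ δ : ℝ, 0 < δ ∧
      ∀ (X : Fin t → Type*) [∀ i, Fintype (X i)] [∀ i, DecidableEq (X i)]
        (H : PartiteThreeGraph X),
        ∃ P : CylinderChainPartition X,
          P.IsQuasirandom H η (fun x => ψ.eval x) ∧
          (P.vertexSize : ℝ) ≤
            twr ⌊10 ^ 5 * (t : ℝ) ^ 6 / η ^ 3⌋₊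
              (max ((ψ.eval (η / (t : ℝ) ^ 2)) ^ (-20 : ℤ)) (ψ.natDegree : ℝ)) ∧
          (P.edgeSize : ℝ) ≤
            twr ⌊10 ^ 5 * (t : ℝ) ^ 6 / η ^ 3⌋₊ (((t : ℝ) ^ 2 / η) ^ 10) ∧
          HoldsForFraction (1 - η) (fun x => δ ≤ (P.graph x).productDensity) := by
  have ht : 1 ≤ t := by
    by_contra h
    rw [show t = 0 by omega] at hηt
    norm_num at hηt
    linarith
  have ht' : (1 : ℝ) ≤ t := by exact_mod_cast ht
  have ht2 : (0 : ℝ) < (t : ℝ) ^ 2 := by positivity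
  set T : ℕ := ⌊10 ^ 5 * (t : ℝ) ^ 6 / η ^ 3⌋₊ with hT
  set a : ℝ := η / (t : ℝ) ^ 2 with ha
  set b : ℝ := (t : ℝ) ^ 2 / η with hb
  have ha0 : 0 < a := by positivity
  have ha1 : a < 1 := (div_lt_one ht2).2 hηt
  have hba : b = a⁻¹ := (inv_div _ _).symm
  have hb1 : 1 ≤ b := (one_le_div hη).2 hηt.le
  set p : ℝ := ψ.eval a with hp
  have hp0 : 0 < p := (hψ_maps a ⟨ha0, ha1⟩).1
  have hp1 : p < 1 := (hψ_maps a ⟨ha0, ha1⟩).2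
  set B : ℝ := b ^ 10 with hB
  set B' : ℝ := max (p ^ (-20 : ℤ)) ψ.natDegree with hB'
  have hB1 : 1 ≤ B := one_le_pow₀ hb1
  have hbB : b ≤ B := le_self_pow₀ hb1 (by norm_num)
  have hpinv : 1 ≤ p⁻¹ := (one_le_inv₀ hp0).2 hp1.le
  have hpB' : p⁻¹ ^ 20 ≤ B' := by
    refine le_trans (le_of_eq ?_) (le_max_left _ _)
    rw [zpow_neg, inv_pow]
    norm_cast
  have hbp : b ≤ p⁻¹ := by
    rw [hba, inv_le_inv₀ ha0 hp0]
    calc p ≤ (2 : ℝ) ^ (-100 : ℤ) * a ^ 28 := hψ_le a ⟨ha0, ha1⟩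
      _ ≤ 1 * a := by
        gcongr
        · norm_num
        · exact pow_le_of_le_one ha0.le ha1.le (by norm_num)
      _ = a := one_mul a
  have hBB' : B ≤ B' :=
    ((pow_le_pow_left₀ (by positivity) hbp 10).trans
      (pow_le_pow_right₀ hpinv (by norm_num))).trans hpB'
  have hpB'' : p⁻¹ ≤ B' := (le_self_pow₀ hpinv (by norm_num)).trans hpB'
  rcases le_or_gt 1 η with hη1 | hη1
  · -- For `η ≥ 1` nothing is required of any tuple.
    refine ⟨1, one_pos, fun X _ _ H => ⟨(ColoredCylinders.trivial X).toPartition, ?_, ?_, ?_, ?_⟩⟩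
    · exact holdsForFraction_of_card_le Finset.univ (by
        rw [Finset.card_univ]
        exact le_mul_of_one_le_left (Nat.cast_nonneg _) hη1) fun x hx =>
          absurd (Finset.mem_univ x) hx
    · rw [ColoredCylinders.vertexSize_toPartition]
      refine le_trans ?_ ((hB1.trans hBB').trans (le_twr T B'))
      exact_mod_cast ColoredCylinders.numCyl_trivial_le
    · refine le_trans ?_ (hB1.trans (le_twr T B))
      exact_mod_cast ColoredCylinders.edgeSize_toPartition_le _
    · exact holdsForFraction_of_card_le Finset.univ (by
        rw [Finset.card_univ]
        exact le_mul_of_one_le_left (Nat.cast_nonneg _) hη1) fun x hx =>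
          absurd (Finset.mem_univ x) hx
  set N : ℕ := ⌈6 * (t : ℝ) ^ 3 / η ^ 3⌉₊ with hN
  have hNle : 4 * (N + 1) + 4 ≤ T := by
    rw [hT, Nat.le_floor_iff (by positivity)]
    have h1 : (N : ℝ) ≤ 6 * (t : ℝ) ^ 3 / η ^ 3 + 1 := (Nat.ceil_lt_add_one (by positivity)).le
    have h2 : (t : ℝ) ^ 3 ≤ t ^ 6 := pow_le_pow_right₀ ht' (by norm_num)
    have h3 : (1 : ℝ) ≤ t ^ 6 / η ^ 3 := by
      rw [one_le_div (by positivity)]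
      exact (pow_le_one₀ hη.le hη1.le).trans (one_le_pow₀ ht')
    have h4 : 6 * (t : ℝ) ^ 3 / η ^ 3 ≤ 6 * (t ^ 6 / η ^ 3) := by
      rw [mul_div_assoc]
      gcongr
    rw [mul_div_assoc]
    push_cast
    linarith
  -- Four exponentials bring the base above the absolute constant which the growth lemmas need.
  have hL : 100 ≤ twr 4 B := by
    refine le_trans ?_ (twr_mono 4 hB1)
    simp only [twr]
    norm_num
  have hM : ∀ M : ℕ, (M : ℝ) ≤ twr (4 * N) (twr 4 B) → (M : ℝ) ≤ twr T B := fun M h => by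
    rw [← twr_add] at h
    exact h.trans (twr_le_twr (by omega) _)
  set R : ℝ := twr T B with hR
  have hR1 : 1 ≤ R := hB1.trans (le_twr T B)
  set ε : ℝ := η / (t ^ 2 * R) with hε
  have hε0 : 0 < ε := by positivity
  have hε1 : ε ≤ 1 := by
    rw [hε, div_le_one (by positivity)]
    nlinarith
  refine ⟨ε ^ (t ^ 2), by positivity, fun X _ _ H => ?_⟩
  obtain ⟨M, S, hqr, hE, hV⟩ := ColoredCylinders.exists_quasirandom hη hη1 ht hψ_maps hψ_mono hψ_le
    H N (ColoredCylinders.trivial X) (L := twr 4 B) (L' := twr 4 B') le_rfl hL (twr_mono 4 hBB')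
    (hbB.trans (le_twr _ _)) (hpB''.trans (le_twr _ _)) ((le_max_right _ _).trans (le_twr _ _))
    (by rw [Nat.cast_one]; linarith)
    ((Nat.cast_le.2 ColoredCylinders.numCyl_trivial_le).trans (by
      rw [Nat.cast_one]
      exact (hB1.trans hBB').trans (le_twr _ _))) (by
    refine (ColoredCylinders.tripleResidual_le _ H).trans ?_
    rw [← mul_assoc]
    refine mul_le_mul_of_nonneg_right ?_ (Nat.cast_nonneg _)
    calc (t : ℝ) ^ 3 = 6 * (t : ℝ) ^ 3 / η ^ 3 * (η ^ 3 / 6) := by field_simp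
      _ ≤ _ := mul_le_mul_of_nonneg_right (Nat.le_ceil _) (by positivity))
  have hMR := hM M hE
  refine ⟨S.toPartition, hqr, ?_, ?_, ?_⟩
  · rw [ColoredCylinders.vertexSize_toPartition]
    rw [← twr_add] at hV
    exact hV.trans (twr_le_twr hNle _)
  · exact (Nat.cast_le.2 S.edgeSize_toPartition_le).trans hMR
  · refine holdsForFraction_of_card_le (S.lowDensity ε) ?_ fun x hx => ?_
    · refine (S.card_lowDensity_le hε0.le).trans (mul_le_mul_of_nonneg_right ?_ (Nat.cast_nonneg _))
      calc (t : ℝ) ^ 2 * M * ε ≤ t ^ 2 * R * ε := by gcongr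
        _ = η := by
          rw [hε]
          field_simp
    · rw [S.productDensity_toPartition]
      exact S.pow_le_productDensity hε0.le hε1 hx
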